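/- Let $N_{ab}\in\mathbb Z$ ($a,b\ge 0$, $N_{00}=0$) be the numbers of rational curves of bidegree $(a,b)$ on a smooth quadric $\mathbb{CP}^1\times\mathbb{CP}^1$ through $2(a+b)-1$ generic points, given as the unique family satisfying $N_{01}=1$, $N_{ab}=N_{ba}$ and, for $a+b\ge 2$, the recursion relations $$2abN_{ab}=\sum N_{a_1b_1}N_{a_2b_2}\,a_1^2b_2^2(a_1b_2-a_2b_1)\binom{2(a+b)-2}{2(a_1+b_1)-1},$$ $$aN_{ab}=\sum N_{a_1b_1}N_{a_2b_2}\,a_1(a_1^2b_2^2-a_2^2b_1^2)\binom{2(a+b)-3}{2(a_1+b_1)-1},$$ $$0=\sum N_{a_1b_1}N_{a_2b_2}\,a_1^2\big[(a_2+b_2-1)(b_1a_2+b_2a_1)-a_2b_2(2(a_1+b_1)-1)\big]\binom{2(a+b)-3}{2(a_1+b_1)-1},$$ $$N_{ab}=\sum N_{a_1b_1}N_{a_2b_2}(a_1b_2+a_2b_1)b_2\Big[a_1\binom{2(a+b)-4}{2(a_1+b_1)-2}-a_2\binom{2(a+b)-4}{2(a_1+b_1)-3}\Big],$$ where the sums are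 over $a_1,a_2,b_1,b_2\ge0$ with $a_1+a_2=a$, $b_1+b_2=b$, and binomial coefficients with a negative entry are $0$. (Such a family exists and is unique.) Let $\mathbb K$ be $\mathbb R$ or $\mathbb C$, and let $U\subset\mathbb K^4$ be the interior of the set of points where the series in $$F=\tfrac12t_1^2t_4+t_1t_2t_3+\sum_{a,b\ge0,\ a+b\ge1}\frac{N_{ab}}{(2(a+b)-1)!}\,t_4^{2(a+b)-1}e^{at_2+bt_3}$$ converges absolutely. With the Euler vector field $E=\frac12t_1\partial_1+\partial_2+\partial_3-\frac12t_4\partial_4$ this is the quantum cohomology Frobenius manifold of $\mathbb{CP}^1\times\mathbb{CP}^1$; that is, $U$ is nonempty, open and connected, $F$ is smooth on $U$, $\eta_{ij}=\partial_1\partial_i\partial_jF$ is a constant nondegenerate matrix (here the antidiagonal one), the structure functions $c_{ij}{}^k=\eta^{kl}\partial_i\partial_j\partial_lF$ define on each tangent space a commutative associative multiplication $\circ$ with unity $\partial_1$, and $\mathcal L_EF=d_F F+{}$(a polynomial of degree at most two) for a constant $d_F$. Let $\mathcal N=\{t\in U: t_2=t_3\}$, parametrized by $t_1=\tau_1$,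 $t_2=t_3=\tau_2/\sqrt2$, $t_4=\tau_3$. Then $\mathcal N$ is a natural Frobenius submanifold with prepotential $F_{\mathcal N}=F|_{\mathcal N}$: in the coordinates $\tau$, the function $F|_{\mathcal N}$ and the vector field $E_{\mathcal N}=pr\,E|_{\mathcal N}$ define a Frobenius manifold whose metric is the induced metric (which is antidiagonal) and whose multiplication is the induced one, $a\star b=pr(a\circ b)$, where $pr$ is the $\eta$-orthogonal projection onto $T\mathcal N$; and $a\star b=a\circ b$ for all $a,b$ tangent to $\mathcal N$. Moreover $E|_{\mathcal N}$ is tangent to $\mathcal N$, $$E_{\mathcal N}=\tfrac12\tau_1\partial_{\tau_1}+\sqrt2\,\partial_{\tau_2}-\tfrac12\tau_3\partial_{\tau_3},\qquad F_{\mathcal N}=\tfrac12\tau_1^2\tau_3+\tfrac12\tau_1\tau_2^2+\sum_{n\ge1}\frac{N_n}{(2n-1)!}\tau_3^{2n-1}e^{n\tau_2/\sqrt2},$$ where $N_n=\sum_{r=0}^nN_{n-r,r}$ are the contracted invariants. These satisfy $N_1=2$ and, for all $n\ge2$, $$N_n=\tfrac14\,(2n-4)!\sum_{k,l\ge1,\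 k+l=n}\frac{kl\,[\,kl(n+1)-(k^2+l^2)\,]}{(2k-1)!\,(2l-1)!}\,N_kN_l .$$ -/

import Mathlib

open scoped ContDiff

namespace FrobeniusMfd

noncomputable section

/-! ### Frobenius manifolds in flat coordinates -/

/-- Partial derivative `∂f/∂tⁱ`. -/
def pd {𝕜 : Type*} [RCLike 𝕜] {m : ℕ} (i : Fin m) (f : (Fin m → 𝕜) → 𝕜) :
    (Fin m → 𝕜) → 𝕜 :=
  fun t => fderiv 𝕜 f t (Pi.single i 1)

/-- The third derivatives `c_{ijk} = ∂³F/∂tⁱ∂tʲ∂tᵏ` of a prepotential `F`. -/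
def c3 {𝕜 : Type*} [RCLike 𝕜] {m : ℕ} (F : (Fin m → 𝕜) → 𝕜) (i j k : Fin m)
    (t : Fin m → 𝕜) : 𝕜 :=
  pd i (pd j (pd k F)) t

/-- The metric `η_{ij} = c_{1ij}` (the first coordinate has index `0` in Lean). -/
def metric {𝕜 : Type*} [RCLike 𝕜] {m : ℕ} [NeZero m] (F : (Fin m → 𝕜) → 𝕜)
    (t : Fin m → 𝕜) : Matrix (Fin m) (Fin m) 𝕜 :=
  Matrix.of fun i j => c3 F 0 i j t

/-- The pairing `⟨a, b⟩ = η_{ij} aⁱ bʲ` on the tangent space at `t`. -/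
def pairing {𝕜 : Type*} [RCLike 𝕜] {m : ℕ} [NeZero m] (F : (Fin m → 𝕜) → 𝕜)
    (t a b : Fin m → 𝕜) : 𝕜 :=
  ∑ i, ∑ j, metric F t i j * a i * b j

/-- The structure functions `c_{ij}^k = η^{kl} c_{ijl}`. -/
def structFun {𝕜 : Type*} [RCLike 𝕜] {m : ℕ} [NeZero m] (F : (Fin m → 𝕜) → 𝕜)
    (i j k : Fin m) (t : Fin m → 𝕜) : 𝕜 :=
  ∑ l, (metric F t)⁻¹ k l * c3 F i j l t

/-- The multiplication `a ∘ b` on the tangent space at `t`,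
determined by `∂_i ∘ ∂_j = c_{ij}^k ∂_k`. -/
def circ {𝕜 : Type*} [RCLike 𝕜] {m : ℕ} [NeZero m] (F : (Fin m → 𝕜) → 𝕜)
    (t a b : Fin m → 𝕜) : Fin m → 𝕜 :=
  fun k => ∑ i, ∑ j, structFun F i j k t * a i * b j

/-- The prepotential `F` and the Euler vector field `E` define a Frobenius manifold on the
region `U` of `𝕜^m`, where `𝕜` is `ℝ` or `ℂ`. -/
structure IsFrobeniusManifold {𝕜 : Type*} [RCLike 𝕜] {m : ℕ} [NeZero m]
    (U : Set (Fin m → 𝕜)) (F : (Fin m → 𝕜) → 𝕜) (E : (Fin m → 𝕜) → (Fin m → 𝕜)) :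
    Prop where
  isOpen : IsOpen U
  isConnected : IsConnected U
  smooth : ContDiffOn 𝕜 ∞ F U
  /-- `η_{ij} = c_{1ij}` is a constant nondegenerate matrix. -/
  normalization : ∃ η : Matrix (Fin m) (Fin m) 𝕜, IsUnit η.det ∧ ∀ t ∈ U, metric F t = η
  circ_comm : ∀ t ∈ U, ∀ a b, circ F t a b = circ F t b a
  circ_assoc : ∀ t ∈ U, ∀ a b c, circ F t (circ F t a b) c = circ F t a (circ F t b c)
  /-- `∂/∂t¹` is the unity. -/
  one_circ : ∀ t ∈ U, ∀ a, circ F t (Pi.single 0 1) a = a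
  /-- `E = (qⁱ_j tʲ + rⁱ) ∂_i`. -/
  euler_affine : ∃ (q : Matrix (Fin m) (Fin m) 𝕜) (r : Fin m → 𝕜),
    ∀ t ∈ U, E t = q.mulVec t + r
  /-- `L_E F = d_F F + (a polynomial of degree at most two)`. -/
  homogeneous : ∃ (dF : 𝕜) (A : Matrix (Fin m) (Fin m) 𝕜) (B : Fin m → 𝕜) (C : 𝕜),
    ∀ t ∈ U, ∑ i, E t i * pd i F t =
      dF * F t + (∑ i, ∑ j, A i j * t i * t j + ∑ i, B i * t i + C)

/-! ### Submanifolds and their induced structures -/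

/-- `φ : V → U` is a parametrization of the submanifold `N` of `U`: an immersion of the open
set `V` which is a homeomorphism onto its image `N`. -/
structure IsParametrization {𝕜 : Type*} [RCLike 𝕜] {m n : ℕ} (U N : Set (Fin m → 𝕜))
    (V : Set (Fin n → 𝕜)) (φ : (Fin n → 𝕜) → (Fin m → 𝕜)) : Prop where
  isOpen : IsOpen V
  smooth : ContDiffOn 𝕜 ∞ φ V
  immersion : ∀ τ ∈ V, Function.Injective (fderiv 𝕜 φ τ)
  embedding : Topology.IsEmbedding (V.domRestrict φ)
  image_eq : φ '' V = N
  subset : N ⊆ U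

/-- The coordinate vector field `∂/∂τ^α = (∂tⁱ/∂τ^α) ∂/∂tⁱ`. -/
def tangentBasis {𝕜 : Type*} [RCLike 𝕜] {m n : ℕ} (φ : (Fin n → 𝕜) → (Fin m → 𝕜))
    (τ : Fin n → 𝕜) (α : Fin n) : Fin m → 𝕜 :=
  fderiv 𝕜 φ τ (Pi.single α 1)

/-- The induced metric `η_{αβ} = ⟨∂/∂τ^α, ∂/∂τ^β⟩`. -/
def inducedMetric {𝕜 : Type*} [RCLike 𝕜] {m n : ℕ} [NeZero m] (F : (Fin m → 𝕜) → 𝕜)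
    (φ : (Fin n → 𝕜) → (Fin m → 𝕜)) (τ : Fin n → 𝕜) : Matrix (Fin n) (Fin n) 𝕜 :=
  Matrix.of fun α β => pairing F (φ τ) (tangentBasis φ τ α) (tangentBasis φ τ β)

/-- The orthogonal projection `pr v` of a tangent vector `v` of the ambient manifold at `φ τ`
onto the tangent space of the submanifold, written in the basis `∂/∂τ^γ`:
`(pr v)^γ = η^{γδ} ⟨v, ∂/∂τ^δ⟩`. -/
def proj {𝕜 : Type*} [RCLike 𝕜] {m n : ℕ} [NeZero m] (F : (Fin m → 𝕜) → 𝕜)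
    (φ : (Fin n → 𝕜) → (Fin m → 𝕜)) (τ : Fin n → 𝕜) (v : Fin m → 𝕜) : Fin n → 𝕜 :=
  fun γ => ∑ δ, (inducedMetric F φ τ)⁻¹ γ δ * pairing F (φ τ) v (tangentBasis φ τ δ)

/-- The induced multiplication `a ⋆ b = pr (a ∘ b)`, in the basis `∂/∂τ^γ`. -/
def inducedMul {𝕜 : Type*} [RCLike 𝕜] {m n : ℕ} [NeZero m] (F : (Fin m → 𝕜) → 𝕜)
    (φ : (Fin n → 𝕜) → (Fin m → 𝕜)) (τ a b : Fin n → 𝕜) : Fin n → 𝕜 :=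
  proj F φ τ (circ F (φ τ) (fderiv 𝕜 φ τ a) (fderiv 𝕜 φ τ b))

/-- The submanifold `N`, parametrized by `φ : V → N`, is a Frobenius submanifold of the
Frobenius manifold `(U, F, E)`, and `G` is its induced prepotential in the flat coordinates
given by `φ`: `G` and `E_N = pr E` define a Frobenius manifold on `V` whose metric and
multiplication are the induced ones. -/
structure IsFrobeniusSubmanifold {𝕜 : Type*} [RCLike 𝕜] {m n : ℕ} [NeZero m] [NeZero n]
    (U : Set (Fin m → 𝕜)) (F : (Fin m → 𝕜) → 𝕜) (E : (Fin m → 𝕜) → (Fin m → 𝕜))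
    (N : Set (Fin m → 𝕜)) (V : Set (Fin n → 𝕜)) (φ : (Fin n → 𝕜) → (Fin m → 𝕜))
    (G : (Fin n → 𝕜) → 𝕜) : Prop where
  ambient : IsFrobeniusManifold U F E
  param : IsParametrization U N V φ
  frobenius : IsFrobeniusManifold V G (fun τ => proj F φ τ (E (φ τ)))
  metric_eq : ∀ τ ∈ V, metric G τ = inducedMetric F φ τ
  circ_eq : ∀ τ ∈ V, ∀ a b, circ G τ a b = inducedMul F φ τ a b

/-- A natural Frobenius submanifold: a Frobenius submanifold with `a ⋆ b = a ∘ b` for all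
vectors `a`, `b` tangent to it. -/
structure IsNaturalFrobeniusSubmanifold {𝕜 : Type*} [RCLike 𝕜] {m n : ℕ} [NeZero m]
    [NeZero n] (U : Set (Fin m → 𝕜)) (F : (Fin m → 𝕜) → 𝕜)
    (E : (Fin m → 𝕜) → (Fin m → 𝕜)) (N : Set (Fin m → 𝕜)) (V : Set (Fin n → 𝕜))
    (φ : (Fin n → 𝕜) → (Fin m → 𝕜)) (G : (Fin n → 𝕜) → 𝕜) : Prop extends
    IsFrobeniusSubmanifold U F E N V φ G where
  natural : ∀ τ ∈ V, ∀ a b : Fin n → 𝕜,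
    fderiv 𝕜 φ τ (inducedMul F φ τ a b) = circ F (φ τ) (fderiv 𝕜 φ τ a) (fderiv 𝕜 φ τ b)

/-- The canonical antidiagonal metric. -/
def antidiagonal {𝕜 : Type*} [RCLike 𝕜] (m : ℕ) : Matrix (Fin m) (Fin m) 𝕜 :=
  Matrix.of fun i j => if (i : ℕ) + j + 1 = m then 1 else 0

/-! ### The quantum cohomology of `ℂP¹ × ℂP¹` -/

/-- The binomial coefficient, zero as soon as one of its entries is negative. -/
def binom (n k : ℤ) : ℤ :=
  if 0 ≤ n ∧ 0 ≤ k then (Nat.choose n.toNat k.toNat : ℤ) else 0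

/-- The sum of `f a₁ b₁ a₂ b₂` over all `a₁, a₂, b₁, b₂ ≥ 0` with `a₁ + a₂ = a` and
`b₁ + b₂ = b`. -/
def splitSum (a b : ℕ) (f : ℕ → ℕ → ℕ → ℕ → ℤ) : ℤ :=
  ∑ p ∈ Finset.HasAntidiagonal.antidiagonal a, ∑ q ∈ Finset.HasAntidiagonal.antidiagonal b, f p.1 q.1 p.2 q.2

/-- The initial conditions, the symmetry and the recursion relations which determine the
numbers `N_{ab}` of rational curves of bidegree `(a, b)` on a smooth quadric through
`2(a+b)-1` generic points (with the convention `N_{00} = 0`). -/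
structure IsQuadricCount (N : ℕ → ℕ → ℤ) : Prop where
  zero_zero : N 0 0 = 0
  zero_one : N 0 1 = 1
  symm : ∀ a b, N a b = N b a
  rec1 : ∀ a b : ℕ, 2 ≤ a + b → 2 * a * b * N a b = splitSum a b fun a₁ b₁ a₂ b₂ =>
    N a₁ b₁ * N a₂ b₂ * a₁ ^ 2 * b₂ ^ 2 * (a₁ * b₂ - a₂ * b₁) *
      binom (2 * (a + b) - 2) (2 * (a₁ + b₁) - 1)
  rec2 : ∀ a b : ℕ, 2 ≤ a + b → a * N a b = splitSum a b fun a₁ b₁ a₂ b₂ =>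
    N a₁ b₁ * N a₂ b₂ * a₁ * (a₁ ^ 2 * b₂ ^ 2 - a₂ ^ 2 * b₁ ^ 2) *
      binom (2 * (a + b) - 3) (2 * (a₁ + b₁) - 1)
  rec3 : ∀ a b : ℕ, 2 ≤ a + b → 0 = splitSum a b fun a₁ b₁ a₂ b₂ =>
    N a₁ b₁ * N a₂ b₂ * a₁ ^ 2 *
      ((a₂ + b₂ - 1) * (b₁ * a₂ + b₂ * a₁) - a₂ * b₂ * (2 * (a₁ + b₁) - 1)) *
      binom (2 * (a + b) - 3) (2 * (a₁ + b₁) - 1)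
  rec4 : ∀ a b : ℕ, 2 ≤ a + b → N a b = splitSum a b fun a₁ b₁ a₂ b₂ =>
    N a₁ b₁ * N a₂ b₂ * (a₁ * b₂ + a₂ * b₁) * b₂ *
      (a₁ * binom (2 * (a + b) - 4) (2 * (a₁ + b₁) - 2) -
        a₂ * binom (2 * (a + b) - 4) (2 * (a₁ + b₁) - 3))

/-- The numbers `N_{ab}`, computed from `N_{01} = N_{10} = 1` by the last recursion relation
(the summands with `(a₁, b₁)` equal to `(0, 0)` or `(a, b)` vanish and are left out). -/
def quadricN (a b : ℕ) : ℤ :=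
  if a + b = 0 then 0
  else if a + b = 1 then 1
  else ∑ i : Fin (a + 1), ∑ j : Fin (b + 1),
    if _h : 0 < (i : ℕ) + j ∧ (i : ℕ) + j < a + b then
      quadricN i j * quadricN (a - i) (b - j) *
        ((i : ℤ) * (b - j : ℕ) + (a - i : ℕ) * (j : ℤ)) * (b - j : ℕ) *
        ((i : ℤ) * binom (2 * (a + b) - 4) (2 * ((i : ℤ) + j) - 2) -
          (a - i : ℕ) * binom (2 * (a + b) - 4) (2 * ((i : ℤ) + j) - 3))
    else 0
termination_by a + b
decreasing_by all_goals omega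

/-- The contracted invariants `N_n = ∑_{r=0}^n N_{n-r,r}`. -/
def contractedN (n : ℕ) : ℤ :=
  ∑ r ∈ Finset.range (n + 1), quadricN (n - r) r

/-- The summand `N_{ab} t₄^{2(a+b)-1} e^{a t₂ + b t₃} / [2(a+b)-1]!` of the prepotential
(it is zero for `a = b = 0`). -/
def quadricTerm {𝕜 : Type*} [RCLike 𝕜] (t : Fin 4 → 𝕜) (p : ℕ × ℕ) : 𝕜 :=
  (quadricN p.1 p.2 : 𝕜) / ((2 * (p.1 + p.2) - 1).factorial : 𝕜) *
    t 3 ^ (2 * (p.1 + p.2) - 1) * NormedSpace.exp ((p.1 : 𝕜) * t 1 + (p.2 : 𝕜) * t 2)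

/-- The region on which the series in the prepotential converges: the interior of the set of
points at which it converges (absolutely). -/
def quadricRegion (𝕜 : Type*) [RCLike 𝕜] : Set (Fin 4 → 𝕜) :=
  interior {t | Summable (quadricTerm t)}

/-- The prepotential of the quantum cohomology of `ℂP¹ × ℂP¹`. -/
def quadricF {𝕜 : Type*} [RCLike 𝕜] (t : Fin 4 → 𝕜) : 𝕜 :=
  1 / 2 * t 0 ^ 2 * t 3 + t 0 * t 1 * t 2 + ∑' p : ℕ × ℕ, quadricTerm t p

/-- The Euler vector field `½ t₁ ∂₁ + ∂₂ + ∂₃ - ½ t₄ ∂₄`. -/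
def quadricE {𝕜 : Type*} [RCLike 𝕜] (t : Fin 4 → 𝕜) : Fin 4 → 𝕜 :=
  ![1 / 2 * t 0, 1, 1, -(1 / 2) * t 3]

/-- The parametrization `(τ₁, τ₂/√2, τ₂/√2, τ₃)` of the hyperplane `t₂ = t₃`. -/
def hyperplaneParam {𝕜 : Type*} [RCLike 𝕜] (τ : Fin 3 → 𝕜) : Fin 4 → 𝕜 :=
  ![τ 0, 1 / ((Real.sqrt 2 : ℝ) : 𝕜) * τ 1, 1 / ((Real.sqrt 2 : ℝ) : 𝕜) * τ 1, τ 2]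

end

end FrobeniusMfd

namespace FrobeniusMfd

/-! ### Formal double power series with their Euler derivations -/

/-- The pairs `((a₁, a₂), (b₁, b₂))` with `a₁ + a₂ = a` and `b₁ + b₂ = b`. -/
def splits (a b : ℕ) : Finset ((ℕ × ℕ) × (ℕ × ℕ)) :=
  Finset.HasAntidiagonal.antidiagonal a ×ˢ Finset.HasAntidiagonal.antidiagonal b

theorem mem_splits {a b : ℕ} {x : (ℕ × ℕ) × (ℕ × ℕ)} :
    x ∈ splits a b ↔ x.1.1 + x.1.2 = a ∧ x.2.1 + x.2.2 = b := by
  simp [splits]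

/-- Formal power series in two variables over `ℚ`. -/
abbrev DPS : Type := PowerSeries (PowerSeries ℚ)

/-- The coefficient of bidegree `(a, b)`. -/
noncomputable def co (a b : ℕ) (f : DPS) : ℚ := PowerSeries.coeff b (PowerSeries.coeff a f)

theorem dps_ext {f g : DPS} (h : ∀ a b, co a b f = co a b g) : f = g :=
  PowerSeries.ext fun a => PowerSeries.ext fun b => h a b

@[simp] theorem co_zero (a b : ℕ) : co a b 0 = 0 := by simp [co]
@[simp] theorem co_add (a b : ℕ) (f g : DPS) : co a b (f + g) = co a b f + co a b g := by
  simp [co]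
@[simp] theorem co_sub (a b : ℕ) (f g : DPS) : co a b (f - g) = co a b f - co a b g := by
  simp [co]
@[simp] theorem co_smul (a b : ℕ) (c : ℚ) (f : DPS) : co a b (c • f) = c * co a b f := by
  simp [co]

theorem co_mul (a b : ℕ) (f g : DPS) : co a b (f * g) =
    ∑ x ∈ splits a b, co x.1.1 x.2.1 f * co x.1.2 x.2.2 g := by
  simp only [co, PowerSeries.coeff_mul, map_sum, splits, Finset.sum_product]

@[simp] theorem co_ofNat_mul (a b : ℕ) (n : ℕ) [n.AtLeastTwo] (f : DPS) :
    co a b (ofNat(n) * f) = ofNat(n) * co a b f := by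
  have : (ofNat(n) : DPS) * f = (ofNat(n) : ℚ) • f := by
    rw [Algebra.smul_def, map_ofNat]
  rw [this, co_smul]

/-- The series with prescribed coefficients. -/
noncomputable def dps (c : ℕ → ℕ → ℚ) : DPS :=
  PowerSeries.mk fun a => PowerSeries.mk fun b => c a b

@[simp] theorem co_dps (c : ℕ → ℕ → ℚ) (a b : ℕ) : co a b (dps c) = c a b := by
  simp [co, dps]

/-- The derivation multiplying each coefficient by an additive weight. -/
noncomputable def weightDerivation (w : ℕ × ℕ →+ ℚ) : Derivation ℚ DPS DPS :=
  Derivation.mk'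
    { toFun := fun f => dps fun a b => w (a, b) * co a b f
      map_add' := fun f g => dps_ext fun a b => by simp [mul_add]
      map_smul' := fun c f => dps_ext fun a b => by simp; ring }
    (fun f g => dps_ext fun a b => by
      simp only [LinearMap.coe_mk, AddHom.coe_mk, co_dps, co_add, smul_eq_mul]
      rw [mul_comm g]
      simp only [co_mul, co_dps, Finset.mul_sum, ← Finset.sum_add_distrib]
      refine Finset.sum_congr rfl fun x hx => ?_
      obtain ⟨h1, h2⟩ := mem_splits.mp hx
      have : w (a, b) = w (x.1.1, x.2.1) + w (x.1.2, x.2.2) := by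
        rw [← map_add, Prod.mk_add_mk, h1, h2]
      rw [this]; ring)

/-- The Euler derivation in the first variable. -/
noncomputable def eulerFst : Derivation ℚ DPS DPS :=
  weightDerivation ((Nat.castAddMonoidHom ℚ).comp (AddMonoidHom.fst ℕ ℕ))

/-- The Euler derivation in the second variable. -/
noncomputable def eulerSnd : Derivation ℚ DPS DPS :=
  weightDerivation ((Nat.castAddMonoidHom ℚ).comp (AddMonoidHom.snd ℕ ℕ))

@[simp] theorem co_eulerFst (a b : ℕ) (f : DPS) : co a b (eulerFst f) = a * co a b f := by
  simp [eulerFst, weightDerivation]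

@[simp] theorem co_eulerSnd (a b : ℕ) (f : DPS) : co a b (eulerSnd f) = b * co a b f := by
  simp [eulerSnd, weightDerivation]

/-- The falling product `(2n-1)(2n-2)⋯(2n-k)`. -/
def fallingProd (n k : ℕ) : ℚ := ∏ l ∈ Finset.range k, (2 * (n : ℚ) - 1 - l)

@[simp] theorem fallingProd_zero (n : ℕ) : fallingProd n 0 = 1 := by simp [fallingProd]
@[simp] theorem fallingProd_succ (n k : ℕ) :
    fallingProd n (k + 1) = fallingProd n k * (2 * (n : ℚ) - 1 - k) := by
  simp [fallingProd, Finset.prod_range_succ]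

/-- The formal counterpart of `∂₂ⁱ ∂₃ʲ ∂₄ᵏ Φ`, up to a power of `t₄`, for
`Φ = ∑ M_{ab} t₄^{2(a+b)-1} e^{a t₂ + b t₃}`. -/
noncomputable def jet (M : ℕ → ℕ → ℚ) (i j k : ℕ) : DPS :=
  dps fun a b => (a : ℚ) ^ i * (b : ℚ) ^ j * fallingProd (a + b) k * M a b

theorem co_jet (M : ℕ → ℕ → ℚ) (i j k a b : ℕ) :
    co a b (jet M i j k) = (a : ℚ) ^ i * (b : ℚ) ^ j * fallingProd (a + b) k * M a b := by
  simp [jet]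

theorem eulerFst_jet (M : ℕ → ℕ → ℚ) (i j k : ℕ) :
    eulerFst (jet M i j k) = jet M (i + 1) j k :=
  dps_ext fun a b => by simp only [co_eulerFst, co_jet]; ring

theorem eulerSnd_jet (M : ℕ → ℕ → ℚ) (i j k : ℕ) :
    eulerSnd (jet M i j k) = jet M i (j + 1) k :=
  dps_ext fun a b => by simp only [co_eulerSnd, co_jet]; ring

/-- The formal counterpart of the derivation `t₄ ∂₄` for homogeneous series. -/
noncomputable def eulerTot : Derivation ℚ DPS DPS := (2 : ℚ) • (eulerFst + eulerSnd)

theorem co_eulerTot (a b : ℕ) (f : DPS) :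
    co a b (eulerTot f) = 2 * ((a + b : ℕ) : ℚ) * co a b f := by
  simp [eulerTot]; ring

theorem eulerTot_jet (M : ℕ → ℕ → ℚ) (i j k : ℕ) :
    eulerTot (jet M i j k) = jet M i j (k + 1) + ((k + 1 : ℕ) : ℚ) • jet M i j k :=
  dps_ext fun a b => by
    simp only [co_eulerTot, co_jet, co_add, co_smul, fallingProd_succ]; push_cast; ring

/-! ### The defects of the associativity equations -/

section defects
variable (M : ℕ → ℕ → ℚ)

/-- Defect of `Φ₂₂₂Φ₃₃₃ = Φ₂₃₃Φ₂₂₃ + 2Φ₂₃₄`. -/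
noncomputable def defectA : DPS :=
  jet M 3 0 0 * jet M 0 3 0 - jet M 2 1 0 * jet M 1 2 0 - 2 * jet M 1 1 1
/-- Defect of `Φ₂₂₂Φ₃₃₄ = Φ₂₃₃Φ₂₂₄ + Φ₂₄₄`. -/
noncomputable def defectB : DPS :=
  jet M 3 0 0 * jet M 0 2 1 - jet M 1 2 0 * jet M 2 0 1 - jet M 1 0 2
/-- Defect of `Φ₃₃₃Φ₂₂₄ = Φ₂₂₃Φ₃₃₄ + Φ₃₄₄`. -/
noncomputable def defectB' : DPS :=
  jet M 0 3 0 * jet M 2 0 1 - jet M 2 1 0 * jet M 0 2 1 - jet M 0 1 2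
/-- Defect of `Φ₂₂₂Φ₃₄₄ + Φ₂₂₃Φ₂₄₄ = 2Φ₂₂₄Φ₂₃₄`. -/
noncomputable def defectG : DPS :=
  jet M 3 0 0 * jet M 0 1 2 + jet M 2 1 0 * jet M 1 0 2 - 2 * (jet M 2 0 1 * jet M 1 1 1)
/-- Defect of `Φ₃₃₃Φ₂₄₄ + Φ₂₃₃Φ₃₄₄ = 2Φ₃₃₄Φ₂₃₄`. -/
noncomputable def defectG' : DPS :=
  jet M 0 3 0 * jet M 1 0 2 + jet M 1 2 0 * jet M 0 1 2 - 2 * (jet M 0 2 1 * jet M 1 1 1)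
/-- Defect of `Φ₄₄₄ + Φ₂₃₃Φ₂₄₄ + Φ₂₂₃Φ₃₄₄ = Φ₂₃₄² + Φ₂₂₄Φ₃₃₄`. -/
noncomputable def defectD : DPS :=
  jet M 0 0 3 + jet M 1 0 2 * jet M 1 2 0 + jet M 0 1 2 * jet M 2 1 0
    - jet M 1 1 1 * jet M 1 1 1 - jet M 2 0 1 * jet M 0 2 1

theorem derivation_two (D : Derivation ℚ DPS DPS) : D 2 = 0 := by
  simpa using D.map_natCast 2

theorem eulerTot_defectA : eulerTot (defectA M) =
    2 * defectA M + eulerSnd (defectB M) + eulerFst (defectB' M) := by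
  simp only [defectA, defectB, defectB', map_sub, map_add, Derivation.leibniz, smul_eq_mul,
    derivation_two, eulerTot_jet, eulerFst_jet, eulerSnd_jet, Algebra.smul_def]
  push_cast
  simp only [map_add, map_ofNat, map_one, zero_add, Nat.reduceAdd]
  ring

theorem eulerTot_defectB : eulerTot (defectB M) =
    3 * defectB M + eulerSnd (defectG M) - eulerFst (defectD M) := by
  simp only [defectD, defectB, defectG, map_sub, map_add, Derivation.leibniz, smul_eq_mul,
    derivation_two, eulerTot_jet, eulerFst_jet, eulerSnd_jet, Algebra.smul_def]
  push_cast
  simp only [map_add, map_ofNat, map_one, zero_add, Nat.reduceAdd]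
  ring

theorem eulerTot_defectB' : eulerTot (defectB' M) =
    3 * defectB' M + eulerFst (defectG' M) - eulerSnd (defectD M) := by
  simp only [defectD, defectB', defectG', map_sub, map_add, Derivation.leibniz, smul_eq_mul,
    derivation_two, eulerTot_jet, eulerFst_jet, eulerSnd_jet, Algebra.smul_def]
  push_cast
  simp only [map_add, map_ofNat, map_one, zero_add, Nat.reduceAdd]
  ring

theorem eulerTot_defectG : eulerTot (defectG M) =
    4 * defectG M + jet M 3 0 0 * eulerSnd (defectD M) + jet M 2 1 0 * eulerFst (defectD M)
      - jet M 1 0 2 * eulerFst (defectA M) + jet M 2 1 1 * defectB M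
      + 2 * (jet M 1 1 1 * eulerFst (defectB M)) + jet M 2 0 1 * eulerSnd (defectB M)
      - jet M 3 0 1 * defectB' M + jet M 2 0 1 * eulerFst (defectB' M)
      - jet M 2 2 0 * defectG M - jet M 1 2 0 * eulerFst (defectG M)
      - jet M 2 1 0 * eulerSnd (defectG M) + jet M 4 0 0 * defectG' M := by
  simp only [defectA, defectB, defectD, defectB', defectG, defectG', map_sub, map_add,
    Derivation.leibniz, smul_eq_mul,
    derivation_two, eulerTot_jet, eulerFst_jet, eulerSnd_jet, Algebra.smul_def]
  push_cast
  simp only [map_add, map_ofNat, map_one, zero_add, Nat.reduceAdd]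
  ring

theorem eulerTot_defectG' : eulerTot (defectG' M) =
    4 * defectG' M + jet M 0 3 0 * eulerFst (defectD M) + jet M 1 2 0 * eulerSnd (defectD M)
      - jet M 0 1 2 * eulerSnd (defectA M) + jet M 1 2 1 * defectB' M
      + 2 * (jet M 1 1 1 * eulerSnd (defectB' M)) + jet M 0 2 1 * eulerFst (defectB' M)
      - jet M 0 3 1 * defectB M + jet M 0 2 1 * eulerSnd (defectB M)
      - jet M 2 2 0 * defectG' M - jet M 2 1 0 * eulerSnd (defectG' M)
      - jet M 1 2 0 * eulerFst (defectG' M) + jet M 0 4 0 * defectG M := by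
  simp only [defectA, defectB, defectD, defectB', defectG, defectG', map_sub, map_add,
    Derivation.leibniz, smul_eq_mul,
    derivation_two, eulerTot_jet, eulerFst_jet, eulerSnd_jet, Algebra.smul_def]
  push_cast
  simp only [map_add, map_ofNat, map_one, zero_add, Nat.reduceAdd]
  ring

end defects

end FrobeniusMfd
namespace FrobeniusMfd

/-! ### Vanishing of the defects -/

/-- All coefficients of total degree below `n` vanish. -/
def VanishBelow (n : ℕ) (f : DPS) : Prop := ∀ a b, a + b < n → co a b f = 0

namespace VanishBelow

theorem add {n : ℕ} {f g : DPS} (hf : VanishBelow n f) (hg : VanishBelow n g) :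
    VanishBelow n (f + g) := fun a b h => by rw [co_add, hf a b h, hg a b h, add_zero]

theorem sub {n : ℕ} {f g : DPS} (hf : VanishBelow n f) (hg : VanishBelow n g) :
    VanishBelow n (f - g) := fun a b h => by rw [co_sub, hf a b h, hg a b h, sub_zero]

theorem fst {n : ℕ} {f : DPS} (hf : VanishBelow n f) : VanishBelow n (eulerFst f) :=
  fun a b h => by rw [co_eulerFst, hf a b h, mul_zero]

theorem snd {n : ℕ} {f : DPS} (hf : VanishBelow n f) : VanishBelow n (eulerSnd f) :=
  fun a b h => by rw [co_eulerSnd, hf a b h, mul_zero]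

theorem two_mul {n : ℕ} {f : DPS} (hf : VanishBelow n f) : VanishBelow n (2 * f) :=
  fun a b h => by rw [co_ofNat_mul, hf a b h, mul_zero]

theorem mul {m n : ℕ} {f g : DPS} (hf : VanishBelow m f) (hg : VanishBelow n g) :
    VanishBelow (m + n) (f * g) := fun a b h => by
  rw [co_mul]
  refine Finset.sum_eq_zero fun x hx => ?_
  have := mem_splits.mp hx
  rcases lt_or_ge (x.1.1 + x.2.1) m with h' | h'
  · rw [hf _ _ h', zero_mul]
  · rw [hg _ _ (by omega), mul_zero]

theorem zero (f : DPS) : VanishBelow 0 f := fun _ _ h => absurd h (Nat.not_lt_zero _)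

theorem eq_zero {f : DPS} (hf : ∀ n, VanishBelow n f) : f = 0 :=
  dps_ext fun a b => by rw [hf (a + b + 1) a b (Nat.lt_succ_self _), co_zero]

end VanishBelow

theorem vanishBelow_jet {M : ℕ → ℕ → ℚ} (h0 : M 0 0 = 0) (i j k : ℕ) :
    VanishBelow 1 (jet M i j k) := fun a b h => by
  obtain ⟨rfl, rfl⟩ : a = 0 ∧ b = 0 := by omega
  rw [co_jet, h0, mul_zero]

/-- If `(2D - d) f` vanishes below degree `n + 1`, `f` vanishes below degree `n`, and `f` also
vanishes in degree `n` in case `2 n = d`, then `f` vanishes below degree `n + 1`. -/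
theorem VanishBelow.step {n d : ℕ} {f : DPS} (hf : VanishBelow n f)
    (h : VanishBelow (n + 1) (eulerTot f - (d : ℚ) • f))
    (hd : 2 * n = d → ∀ a b, a + b = n → co a b f = 0) : VanishBelow (n + 1) f := by
  intro a b hab
  rcases Nat.lt_succ_iff_lt_or_eq.mp hab with h' | h'
  · exact hf a b h'
  · by_cases h2 : 2 * n = d
    · exact hd h2 a b h'
    · have := h a b hab
      rw [co_sub, co_eulerTot, co_smul, ← sub_mul, h'] at this
      refine (mul_eq_zero.mp this).resolve_left (sub_ne_zero.mpr ?_)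
      exact_mod_cast h2

/-- For initial values of the expected form, the equation `Φ₄₄₄ = ⋯` implies all the other
associativity equations. -/
theorem defects_eq_zero {M : ℕ → ℕ → ℚ} (h0 : M 0 0 = 0) (h1 : M 0 1 = 1) (h2 : M 1 0 = 1)
    (hD : defectD M = 0) :
    defectA M = 0 ∧ defectB M = 0 ∧ defectB' M = 0 ∧ defectG M = 0 ∧ defectG' M = 0 := by
  have j := fun i j k => vanishBelow_jet h0 i j k
  have hsmul : ∀ (d : ℕ) [d.AtLeastTwo] (f : DPS),
      ((d : ℕ) : ℚ) • f = (OfNat.ofNat d : DPS) * f := fun d _ f => by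
    rw [Algebra.smul_def, map_natCast]; rfl
  have key : ∀ n, VanishBelow n (defectA M) ∧ VanishBelow n (defectB M) ∧
      VanishBelow n (defectB' M) ∧ VanishBelow n (defectG M) ∧ VanishBelow n (defectG' M) := by
    intro n
    induction n with
    | zero => exact ⟨.zero _, .zero _, .zero _, .zero _, .zero _⟩
    | succ n ih =>
      obtain ⟨hA, hB, hB', hG, hG'⟩ := ih
      rw [add_comm n 1]
      have low : ∀ {f : DPS} (i k l : ℕ), VanishBelow n f → VanishBelow (1 + n) (jet M i k l * f) :=
        fun i k l hf => (j i k l).mul hf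
      have deg2 : ∀ a b, a + b = 2 → co a b (defectG M) = 0 ∧ co a b (defectG' M) = 0 := by
        intro a b hab
        have : (a = 0 ∧ b = 2) ∨ (a = 1 ∧ b = 1) ∨ (a = 2 ∧ b = 0) := by omega
        rcases this with ⟨rfl, rfl⟩ | ⟨rfl, rfl⟩ | ⟨rfl, rfl⟩ <;>
        constructor <;>
        norm_num [defectG, defectG', co_mul, splits, Finset.sum_product, co_jet, h0, h1, h2,
          Finset.Nat.antidiagonal_succ]
      have hG1 : VanishBelow (1 + n) (defectG M) := by
        rw [add_comm 1 n]
        refine hG.step (d := 4) ?_ (fun h a b hab => (deg2 a b (by omega)).1)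
        rw [hsmul 4, eulerTot_defectG, hD, add_comm n 1, map_zero, map_zero]
        convert (((((((((low 2 1 1 hB).sub (low 1 0 2 hA.fst)).add (low 1 1 1 hB.fst).two_mul).add
          (low 2 0 1 hB.snd)).sub (low 3 0 1 hB')).add (low 2 0 1 hB'.fst)).sub
          (low 2 2 0 hG)).sub (low 1 2 0 hG.fst)).sub (low 2 1 0 hG.snd)).add
          (low 4 0 0 hG') using 1
        ring
      have hG1' : VanishBelow (1 + n) (defectG' M) := by
        rw [add_comm 1 n]
        refine hG'.step (d := 4) ?_ (fun h a b hab => (deg2 a b (by omega)).2)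
        rw [hsmul 4, eulerTot_defectG', hD, add_comm n 1, map_zero, map_zero]
        convert (((((((((low 1 2 1 hB').sub (low 0 1 2 hA.snd)).add (low 1 1 1 hB'.snd).two_mul).add
          (low 0 2 1 hB'.fst)).sub (low 0 3 1 hB)).add (low 0 2 1 hB.snd)).sub
          (low 2 2 0 hG')).sub (low 2 1 0 hG'.snd)).sub (low 1 2 0 hG'.fst)).add
          (low 0 4 0 hG) using 1
        ring
      have hB1 : VanishBelow (1 + n) (defectB M) := by
        rw [add_comm 1 n]
        refine hB.step (d := 3) ?_ (fun h => by omega)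
        rw [hsmul 3, eulerTot_defectB, hD, add_comm n 1, map_zero]
        convert hG1.snd using 1
        ring
      have hB1' : VanishBelow (1 + n) (defectB' M) := by
        rw [add_comm 1 n]
        refine hB'.step (d := 3) ?_ (fun h => by omega)
        rw [hsmul 3, eulerTot_defectB', hD, add_comm n 1, map_zero]
        convert hG1'.fst using 1
        ring
      refine ⟨?_, hB1, hB1', hG1, hG1'⟩
      rw [add_comm 1 n]
      refine hA.step (d := 2) ?_ (fun h a b hab => ?_)
      · rw [hsmul 2, eulerTot_defectA, add_comm n 1]
        convert hB1.snd.add hB1'.fst using 1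
        ring
      · have : (a = 0 ∧ b = 1) ∨ (a = 1 ∧ b = 0) := by omega
        rcases this with ⟨rfl, rfl⟩ | ⟨rfl, rfl⟩ <;>
        simp [defectA, co_mul, splits, Finset.sum_product, co_jet, h0,
          Finset.Nat.antidiagonal_succ]
  exact ⟨VanishBelow.eq_zero fun n => (key n).1, VanishBelow.eq_zero fun n => (key n).2.1,
    VanishBelow.eq_zero fun n => (key n).2.2.1, VanishBelow.eq_zero fun n => (key n).2.2.2.1,
    VanishBelow.eq_zero fun n => (key n).2.2.2.2⟩

end FrobeniusMfd
namespace FrobeniusMfd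

/-! ### The recursion relations and the defects -/

theorem splitSum_eq (a b : ℕ) (f : ℕ → ℕ → ℕ → ℕ → ℤ) :
    splitSum a b f = ∑ x ∈ splits a b, f x.1.1 x.2.1 x.1.2 x.2.2 := by
  simp only [splitSum, splits, Finset.sum_product]

theorem binom_natCast (n k : ℕ) : binom n k = n.choose k := by simp [binom]

theorem binom_of_neg (n : ℤ) {k : ℤ} (hk : k < 0) : binom n k = 0 := by
  rw [binom, if_neg]; omega

/-- The coefficients `N_{ab} / (2(a+b)-1)!` of the prepotential. -/
noncomputable def potCoeff (N : ℕ → ℕ → ℤ) (a b : ℕ) : ℚ :=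
  N a b / ((2 * (a + b) - 1).factorial : ℚ)

theorem cast_binom_add (i j : ℕ) : ((binom ((i + j : ℕ) : ℤ) (i : ℤ) : ℤ) : ℚ) =
    ((i + j).factorial : ℚ) / (i.factorial * j.factorial) := by
  rw [binom_natCast, Int.cast_natCast, Nat.cast_add_choose]

variable {N : ℕ → ℕ → ℤ}

theorem co_jet_potCoeff (i j k a b m : ℕ) (h : a + b = m + 1) :
    co a b (jet (potCoeff N) i j k) = (a : ℚ) ^ i * (b : ℚ) ^ j * fallingProd (m + 1) k *
      (N a b / ((2 * m + 1 : ℚ) * ((2 * m).factorial : ℚ))) := by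
  rw [co_jet, potCoeff, h, show 2 * (m + 1) - 1 = 2 * m + 1 by omega, Nat.factorial_succ]
  push_cast; rfl

theorem co_jet_potCoeff_zero (h0 : N 0 0 = 0) (i j k a b : ℕ) (h : a + b = 0) :
    co a b (jet (potCoeff N) i j k) = 0 := by
  exact vanishBelow_jet (by simp [potCoeff, h0]) i j k a b (by omega)

/-- Induction principle for summands: the summands with one trivial factor vanish. -/
theorem summand_cases {P : ℕ → ℕ → ℕ → ℕ → Prop} (hl : ∀ a₁ b₁ a₂ b₂, a₁ + b₁ = 0 → P a₁ b₁ a₂ b₂)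
    (hr : ∀ a₁ b₁ a₂ b₂, a₂ + b₂ = 0 → P a₁ b₁ a₂ b₂)
    (h : ∀ a₁ b₁ a₂ b₂ m₁ m₂, a₁ + b₁ = m₁ + 1 → a₂ + b₂ = m₂ + 1 → P a₁ b₁ a₂ b₂)
    (a₁ b₁ a₂ b₂ : ℕ) : P a₁ b₁ a₂ b₂ := by
  rcases Nat.eq_zero_or_pos (a₁ + b₁) with h1 | h1
  · exact hl _ _ _ _ h1
  rcases Nat.eq_zero_or_pos (a₂ + b₂) with h2 | h2
  · exact hr _ _ _ _ h2
  exact h _ _ _ _ (a₁ + b₁ - 1) (a₂ + b₂ - 1) (by omega) (by omega)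

theorem eq_zero_of_add_eq_zero (h0 : N 0 0 = 0) {a b : ℕ} (h : a + b = 0) : N a b = 0 := by
  obtain ⟨rfl, rfl⟩ : a = 0 ∧ b = 0 := by omega
  exact h0

theorem rec1_summand (h0 : N 0 0 = 0) (a₁ b₁ a₂ b₂ : ℕ) (a b : ℕ) (ha : a₁ + a₂ = a)
    (hb : b₁ + b₂ = b) :
    ((N a₁ b₁ * N a₂ b₂ * a₁ ^ 2 * b₂ ^ 2 * (a₁ * b₂ - a₂ * b₁) *
      binom (2 * (a + b) - 2) (2 * (a₁ + b₁) - 1) : ℤ) : ℚ) =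
    ((2 * (a + b) - 2).factorial : ℚ) *
      (co a₁ b₁ (jet (potCoeff N) 3 0 0) * co a₂ b₂ (jet (potCoeff N) 0 3 0) -
        co a₁ b₁ (jet (potCoeff N) 2 1 0) * co a₂ b₂ (jet (potCoeff N) 1 2 0)) := by
  subst ha hb
  induction a₁, b₁, a₂, b₂ using summand_cases with
  | hl a₁ b₁ a₂ b₂ h => simp [co_jet_potCoeff_zero h0 _ _ _ _ _ h, eq_zero_of_add_eq_zero h0 h]
  | hr a₁ b₁ a₂ b₂ h => simp [co_jet_potCoeff_zero h0 _ _ _ _ _ h, eq_zero_of_add_eq_zero h0 h]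
  | h a₁ b₁ a₂ b₂ m₁ m₂ h1 h2 =>
    have e1 : 2 * (a₁ + a₂ + (b₁ + b₂)) - 2 = (2 * m₁ + 1) + (2 * m₂ + 1) := by omega
    have e2 : (2 * (((a₁ + a₂ : ℕ) : ℤ) + ((b₁ + b₂ : ℕ) : ℤ)) - 2) =
      (((2 * m₁ + 1) + (2 * m₂ + 1) : ℕ) : ℤ) := by omega
    have e3 : (2 * ((a₁ : ℤ) + b₁) - 1) = ((2 * m₁ + 1 : ℕ) : ℤ) := by omega
    rw [e1, e2, e3]
    push_cast only [Int.cast_mul, Int.cast_pow, Int.cast_sub, Int.cast_natCast]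
    rw [cast_binom_add]
    simp only [co_jet_potCoeff _ _ _ _ _ _ h1, co_jet_potCoeff _ _ _ _ _ _ h2,
      Nat.factorial_succ (2 * m₁), Nat.factorial_succ (2 * m₂), fallingProd_zero]
    push_cast
    field_simp

theorem rec2_summand (h0 : N 0 0 = 0) (a₁ b₁ a₂ b₂ : ℕ) (a b : ℕ) (ha : a₁ + a₂ = a)
    (hb : b₁ + b₂ = b) :
    ((N a₁ b₁ * N a₂ b₂ * a₁ * (a₁ ^ 2 * b₂ ^ 2 - a₂ ^ 2 * b₁ ^ 2) *
      binom (2 * (a + b) - 3) (2 * (a₁ + b₁) - 1) : ℤ) : ℚ) =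
    ((2 * (a + b) - 3).factorial : ℚ) *
      (co a₁ b₁ (jet (potCoeff N) 3 0 0) * co a₂ b₂ (jet (potCoeff N) 0 2 1) -
        co a₁ b₁ (jet (potCoeff N) 1 2 0) * co a₂ b₂ (jet (potCoeff N) 2 0 1)) := by
  subst ha hb
  induction a₁, b₁, a₂, b₂ using summand_cases with
  | hl a₁ b₁ a₂ b₂ h => simp [co_jet_potCoeff_zero h0 _ _ _ _ _ h, eq_zero_of_add_eq_zero h0 h]
  | hr a₁ b₁ a₂ b₂ h => simp [co_jet_potCoeff_zero h0 _ _ _ _ _ h, eq_zero_of_add_eq_zero h0 h]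
  | h a₁ b₁ a₂ b₂ m₁ m₂ h1 h2 =>
    have e1 : 2 * (a₁ + a₂ + (b₁ + b₂)) - 3 = (2 * m₁ + 1) + 2 * m₂ := by omega
    have e2 : (2 * (((a₁ + a₂ : ℕ) : ℤ) + ((b₁ + b₂ : ℕ) : ℤ)) - 3) =
      (((2 * m₁ + 1) + 2 * m₂ : ℕ) : ℤ) := by omega
    have e3 : (2 * ((a₁ : ℤ) + b₁) - 1) = ((2 * m₁ + 1 : ℕ) : ℤ) := by omega
    rw [e1, e2, e3]
    push_cast only [Int.cast_mul, Int.cast_pow, Int.cast_sub, Int.cast_natCast]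
    rw [cast_binom_add]
    simp only [co_jet_potCoeff _ _ _ _ _ _ h1, co_jet_potCoeff _ _ _ _ _ _ h2,
      Nat.factorial_succ (2 * m₁), fallingProd_zero, fallingProd_succ]
    push_cast
    field_simp
    ring

theorem rec3_summand (h0 : N 0 0 = 0) (a₁ b₁ a₂ b₂ : ℕ) (a b : ℕ) (ha : a₁ + a₂ = a)
    (hb : b₁ + b₂ = b) :
    ((N a₁ b₁ * N a₂ b₂ * a₁ ^ 2 *
      ((a₂ + b₂ - 1) * (b₁ * a₂ + b₂ * a₁) - a₂ * b₂ * (2 * (a₁ + b₁) - 1)) *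
      binom (2 * (a + b) - 3) (2 * (a₁ + b₁) - 1) : ℤ) : ℚ) =
    ((2 * (a + b) - 3).factorial : ℚ) / 2 *
      (co a₁ b₁ (jet (potCoeff N) 3 0 0) * co a₂ b₂ (jet (potCoeff N) 0 1 2) +
        co a₁ b₁ (jet (potCoeff N) 2 1 0) * co a₂ b₂ (jet (potCoeff N) 1 0 2) -
        2 * (co a₁ b₁ (jet (potCoeff N) 2 0 1) * co a₂ b₂ (jet (potCoeff N) 1 1 1))) := by
  subst ha hb
  induction a₁, b₁, a₂, b₂ using summand_cases with
  | hl a₁ b₁ a₂ b₂ h => simp [co_jet_potCoeff_zero h0 _ _ _ _ _ h, eq_zero_of_add_eq_zero h0 h]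
  | hr a₁ b₁ a₂ b₂ h => simp [co_jet_potCoeff_zero h0 _ _ _ _ _ h, eq_zero_of_add_eq_zero h0 h]
  | h a₁ b₁ a₂ b₂ m₁ m₂ h1 h2 =>
    have e1 : 2 * (a₁ + a₂ + (b₁ + b₂)) - 3 = (2 * m₁ + 1) + 2 * m₂ := by omega
    have e2 : (2 * (((a₁ + a₂ : ℕ) : ℤ) + ((b₁ + b₂ : ℕ) : ℤ)) - 3) =
      (((2 * m₁ + 1) + 2 * m₂ : ℕ) : ℤ) := by omega
    have e3 : (2 * ((a₁ : ℤ) + b₁) - 1) = ((2 * m₁ + 1 : ℕ) : ℤ) := by omega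
    have e4 : ((a₂ : ℤ) + b₂ - 1) = m₂ := by omega
    rw [e1, e2, e3, e4]
    push_cast only [Int.cast_mul, Int.cast_pow, Int.cast_sub, Int.cast_add, Int.cast_natCast]
    rw [cast_binom_add]
    simp only [co_jet_potCoeff _ _ _ _ _ _ h1, co_jet_potCoeff _ _ _ _ _ _ h2,
      Nat.factorial_succ (2 * m₁), fallingProd_zero, fallingProd_succ]
    push_cast
    field_simp
    ring

theorem rec4_summand (h0 : N 0 0 = 0) (a₁ b₁ a₂ b₂ : ℕ) (a b : ℕ) (ha : a₁ + a₂ = a)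
    (hb : b₁ + b₂ = b) :
    ((N a₁ b₁ * N a₂ b₂ * (a₁ * b₂ + a₂ * b₁) * b₂ *
      (a₁ * binom (2 * (a + b) - 4) (2 * (a₁ + b₁) - 2) -
        a₂ * binom (2 * (a + b) - 4) (2 * (a₁ + b₁) - 3)) : ℤ) : ℚ) =
    ((2 * (a + b) - 4).factorial : ℚ) *
      (co a₁ b₁ (jet (potCoeff N) 1 1 1) * co a₂ b₂ (jet (potCoeff N) 1 1 1) +
        co a₁ b₁ (jet (potCoeff N) 2 0 1) * co a₂ b₂ (jet (potCoeff N) 0 2 1) -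
        co a₁ b₁ (jet (potCoeff N) 1 0 2) * co a₂ b₂ (jet (potCoeff N) 1 2 0) -
        co a₁ b₁ (jet (potCoeff N) 0 1 2) * co a₂ b₂ (jet (potCoeff N) 2 1 0)) := by
  subst ha hb
  induction a₁, b₁, a₂, b₂ using summand_cases with
  | hl a₁ b₁ a₂ b₂ h => simp [co_jet_potCoeff_zero h0 _ _ _ _ _ h, eq_zero_of_add_eq_zero h0 h]
  | hr a₁ b₁ a₂ b₂ h => simp [co_jet_potCoeff_zero h0 _ _ _ _ _ h, eq_zero_of_add_eq_zero h0 h]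
  | h a₁ b₁ a₂ b₂ m₁ m₂ h1 h2 =>
    have e1 : 2 * (a₁ + a₂ + (b₁ + b₂)) - 4 = 2 * m₁ + 2 * m₂ := by omega
    have e2 : (2 * (((a₁ + a₂ : ℕ) : ℤ) + ((b₁ + b₂ : ℕ) : ℤ)) - 4) =
      ((2 * m₁ + 2 * m₂ : ℕ) : ℤ) := by omega
    have e3 : (2 * ((a₁ : ℤ) + b₁) - 2) = ((2 * m₁ : ℕ) : ℤ) := by omega
    have e4 : ((binom ((2 * m₁ + 2 * m₂ : ℕ) : ℤ) (2 * ((a₁ : ℤ) + b₁) - 3) : ℤ) : ℚ) =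
        ((2 * m₁ + 2 * m₂).factorial : ℚ) * (2 * m₁) /
          ((2 * m₁).factorial * ((2 * m₂ + 1) * (2 * m₂).factorial)) := by
      rcases m₁ with _ | k
      · rw [binom_of_neg _ (by omega)]; simp
      · rw [show 2 * ((a₁ : ℤ) + b₁) - 3 = ((2 * k + 1 : ℕ) : ℤ) by omega,
          show 2 * (k + 1) + 2 * m₂ = (2 * k + 1) + (2 * m₂ + 1) by ring, cast_binom_add,
          show 2 * (k + 1) = (2 * k + 1) + 1 by ring, Nat.factorial_succ (2 * k + 1),
          Nat.factorial_succ (2 * m₂)]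
        push_cast
        field_simp
        ring
    rw [e1, e2, e3]
    push_cast only [Int.cast_mul, Int.cast_pow, Int.cast_sub, Int.cast_add, Int.cast_natCast]
    rw [cast_binom_add, e4]
    simp only [co_jet_potCoeff _ _ _ _ _ _ h1, co_jet_potCoeff _ _ _ _ _ _ h2,
      fallingProd_zero, fallingProd_succ]
    push_cast
    field_simp
    ring

/-- The fourth recursion relation at `(a, b)`. -/
def RecFour (N : ℕ → ℕ → ℤ) (a b : ℕ) : Prop :=
  N a b = splitSum a b fun a₁ b₁ a₂ b₂ =>
    N a₁ b₁ * N a₂ b₂ * (a₁ * b₂ + a₂ * b₁) * b₂ *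
      (a₁ * binom (2 * (a + b) - 4) (2 * (a₁ + b₁) - 2) -
        a₂ * binom (2 * (a + b) - 4) (2 * (a₁ + b₁) - 3))

theorem potCoeff_zero (h0 : N 0 0 = 0) : potCoeff N 0 0 = 0 := by simp [potCoeff, h0]

theorem recFour_iff (h0 : N 0 0 = 0) {a b : ℕ} (hab : 2 ≤ a + b) :
    RecFour N a b ↔ co a b (defectD (potCoeff N)) = 0 := by
  have hf : ((2 * (a + b) - 4).factorial : ℚ) ≠ 0 := by positivity
  have e : (N a b : ℚ) = ((2 * (a + b) - 4).factorial : ℚ) * co a b (jet (potCoeff N) 0 0 3) := by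
    obtain ⟨k, hk⟩ : ∃ k, a + b = k + 2 := ⟨a + b - 2, by omega⟩
    rw [co_jet_potCoeff _ _ _ _ _ (k + 1) hk, hk, show 2 * (k + 2) - 4 = 2 * k by omega,
      show 2 * (k + 1) = 2 * k + 1 + 1 by ring, Nat.factorial_succ, Nat.factorial_succ]
    simp only [fallingProd_zero, fallingProd_succ]
    push_cast
    field_simp
    ring
  rw [RecFour, splitSum_eq, ← @Int.cast_inj ℚ, Int.cast_sum, e]
  rw [Finset.sum_congr rfl fun x hx => rec4_summand h0 x.1.1 x.2.1 x.1.2 x.2.2 a b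
    (mem_splits.mp hx).1 (mem_splits.mp hx).2, ← Finset.mul_sum, mul_right_inj' hf]
  simp only [defectD, co_sub, co_add, co_mul, Finset.sum_sub_distrib, Finset.sum_add_distrib]
  constructor <;> intro h <;> linear_combination h

theorem defectD_low (h0 : N 0 0 = 0) {a b : ℕ} (hab : a + b < 2) :
    co a b (defectD (potCoeff N)) = 0 := by
  have j := fun i j k => vanishBelow_jet (potCoeff_zero h0) i j k
  have : co a b (jet (potCoeff N) 0 0 3) = 0 := by
    rcases Nat.eq_zero_or_pos (a + b) with h | h
    · exact j _ _ _ _ _ (by omega)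
    · rw [co_jet, show a + b = 1 by omega]; norm_num
  simp only [defectD, co_sub, co_add, this, ((j _ _ _).mul (j _ _ _)) a b hab]
  norm_num

theorem defectD_eq_zero_iff (h0 : N 0 0 = 0) :
    defectD (potCoeff N) = 0 ↔ ∀ a b, 2 ≤ a + b → RecFour N a b := by
  constructor
  · intro h a b hab
    rw [recFour_iff h0 hab, h, co_zero]
  · intro h
    refine dps_ext fun a b => ?_
    rcases lt_or_ge (a + b) 2 with hab | hab
    · rw [defectD_low h0 hab, co_zero]
    · rw [(recFour_iff h0 hab).mp (h a b hab), co_zero]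

/-- The fourth relation and the initial values determine the numbers. -/
theorem eq_of_recFour {N N' : ℕ → ℕ → ℤ} (h : ∀ a b, a + b < 2 → N a b = N' a b)
    (h0 : N 0 0 = 0) (hN : ∀ a b, 2 ≤ a + b → RecFour N a b)
    (hN' : ∀ a b, 2 ≤ a + b → RecFour N' a b) : N = N' := by
  have key : ∀ n a b, a + b = n → N a b = N' a b := by
    intro n
    induction n using Nat.strong_induction_on with
    | _ n ih =>
      intro a b hab
      rcases lt_or_ge (a + b) 2 with h2 | h2
      · exact h a b h2
      rw [hN a b h2, hN' a b h2, splitSum_eq, splitSum_eq]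
      refine Finset.sum_congr rfl fun x hx => ?_
      have hx := mem_splits.mp hx
      have h0' : N' 0 0 = 0 := by rw [← h 0 0 (by omega), h0]
      by_cases e1 : x.1.1 + x.2.1 = 0
      · rw [eq_zero_of_add_eq_zero h0 e1, eq_zero_of_add_eq_zero h0' e1]; simp
      by_cases e2 : x.1.2 + x.2.2 = 0
      · rw [eq_zero_of_add_eq_zero h0 e2, eq_zero_of_add_eq_zero h0' e2]; simp
      rw [ih (x.1.1 + x.2.1) (by omega) _ _ rfl, ih (x.1.2 + x.2.2) (by omega) _ _ rfl]
  funext a b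
  exact key _ a b rfl

theorem quadricN_zero : quadricN 0 0 = 0 := by rw [quadricN]; simp

theorem quadricN_one {a b : ℕ} (h : a + b = 1) : quadricN a b = 1 := by
  rw [quadricN, if_neg (by omega), if_pos h]

theorem recFour_quadricN {a b : ℕ} (hab : 2 ≤ a + b) : RecFour quadricN a b := by
  rw [RecFour, quadricN, if_neg (by omega), if_neg (by omega), splitSum,
    Finset.Nat.sum_antidiagonal_eq_sum_range_succ_mk, Finset.sum_range]
  refine Finset.sum_congr rfl fun i _ => ?_
  rw [Finset.Nat.sum_antidiagonal_eq_sum_range_succ_mk, Finset.sum_range]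
  refine Finset.sum_congr rfl fun j _ => ?_
  have hi := i.2
  have hj := j.2
  split_ifs with h
  · rfl
  · by_cases e1 : (i : ℕ) + j = 0
    · simp [eq_zero_of_add_eq_zero quadricN_zero e1]
    · simp [eq_zero_of_add_eq_zero quadricN_zero (show (a - i) + (b - j) = 0 by omega)]

theorem defectD_quadricN : defectD (potCoeff quadricN) = 0 :=
  (defectD_eq_zero_iff quadricN_zero).mpr fun _ _ => recFour_quadricN

theorem co_swap_jet (i j k a b : ℕ) :
    co a b (jet (potCoeff fun a b => N b a) i j k) = co b a (jet (potCoeff N) j i k) := by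
  simp only [co_jet, potCoeff, add_comm b a]; ring

theorem co_mul_swap {f g f' g' : DPS} (hf : ∀ a b, co a b f' = co b a f)
    (hg : ∀ a b, co a b g' = co b a g) (a b : ℕ) : co a b (f' * g') = co b a (f * g) := by
  simp only [co_mul, splits, Finset.sum_product, hf, hg]
  rw [Finset.sum_comm]

theorem quadricN_symm (a b : ℕ) : quadricN a b = quadricN b a := by
  have : quadricN = fun a b => quadricN b a := by
    refine eq_of_recFour (fun a b h => ?_) quadricN_zero (fun a b => recFour_quadricN) ?_
    · rcases Nat.eq_zero_or_pos (a + b) with h' | h'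
      · rw [eq_zero_of_add_eq_zero quadricN_zero h',
          eq_zero_of_add_eq_zero quadricN_zero ((add_comm b a).trans h')]
      · rw [quadricN_one (by omega), quadricN_one (by omega)]
    · refine (defectD_eq_zero_iff (N := fun a b => quadricN b a) quadricN_zero).mp ?_
      refine dps_ext fun a b => ?_
      have := congrArg (co b a) defectD_quadricN
      simp only [defectD, co_sub, co_add, co_zero] at this ⊢
      have hm : ∀ i j k i' j' k', co a b (jet (potCoeff fun a b => quadricN b a) i j k *
          jet (potCoeff fun a b => quadricN b a) i' j' k') =
          co b a (jet (potCoeff quadricN) j i k * jet (potCoeff quadricN) j' i' k') :=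
        fun i j k i' j' k' => co_mul_swap (co_swap_jet _ _ _) (co_swap_jet _ _ _) a b
      simp only [hm, co_swap_jet]
      rw [mul_comm (jet _ 0 2 1)]
      linear_combination this
  exact congrFun (congrFun this a) b

/-- The formal series of third derivatives of the prepotential. -/
noncomputable abbrev qjet (i j k : ℕ) : DPS := jet (potCoeff quadricN) i j k

theorem defects_quadricN : defectA (potCoeff quadricN) = 0 ∧ defectB (potCoeff quadricN) = 0 ∧
    defectB' (potCoeff quadricN) = 0 ∧ defectG (potCoeff quadricN) = 0 ∧
    defectG' (potCoeff quadricN) = 0 :=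
  defects_eq_zero (potCoeff_zero quadricN_zero) (by simp [potCoeff, quadricN_one])
    (by simp [potCoeff, quadricN_one]) defectD_quadricN

theorem isQuadricCount_quadricN : IsQuadricCount quadricN where
  zero_zero := quadricN_zero
  zero_one := quadricN_one rfl
  symm := quadricN_symm
  rec1 a b hab := by
    have h := congrArg (co a b) defects_quadricN.1
    rw [splitSum_eq, ← @Int.cast_inj ℚ, Int.cast_sum,
      Finset.sum_congr rfl fun x hx => rec1_summand quadricN_zero x.1.1 x.2.1 x.1.2 x.2.2 a b
      (mem_splits.mp hx).1 (mem_splits.mp hx).2, ← Finset.mul_sum]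
    simp only [defectA, co_sub, co_ofNat_mul, co_zero] at h
    simp only [co_mul] at h
    rw [Finset.sum_sub_distrib, sub_eq_zero.mp h]
    obtain ⟨k, hk⟩ : ∃ k, a + b = k + 1 := ⟨a + b - 1, by omega⟩
    rw [co_jet_potCoeff _ _ _ _ _ k hk, hk, show 2 * (k + 1) - 2 = 2 * k by omega]
    simp only [fallingProd_zero, fallingProd_succ]
    push_cast
    field_simp
    ring
  rec2 a b hab := by
    have h := congrArg (co a b) defects_quadricN.2.1
    rw [splitSum_eq, ← @Int.cast_inj ℚ, Int.cast_sum,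
      Finset.sum_congr rfl fun x hx => rec2_summand quadricN_zero x.1.1 x.2.1 x.1.2 x.2.2 a b
      (mem_splits.mp hx).1 (mem_splits.mp hx).2, ← Finset.mul_sum]
    simp only [defectB, co_sub, co_zero, co_mul] at h
    rw [Finset.sum_sub_distrib, sub_eq_zero.mp h]
    obtain ⟨k, hk⟩ : ∃ k, a + b = k + 2 := ⟨a + b - 2, by omega⟩
    rw [co_jet_potCoeff _ _ _ _ _ (k + 1) hk, hk, show 2 * (k + 2) - 3 = 2 * k + 1 by omega,
      show 2 * (k + 1) = 2 * k + 1 + 1 by ring, Nat.factorial_succ (2 * k + 1)]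
    simp only [fallingProd_zero, fallingProd_succ]
    push_cast
    field_simp
    ring
  rec3 a b hab := by
    have h := congrArg (co a b) defects_quadricN.2.2.2.1
    rw [splitSum_eq, ← @Int.cast_inj ℚ, Int.cast_sum,
      Finset.sum_congr rfl fun x hx => rec3_summand quadricN_zero x.1.1 x.2.1 x.1.2 x.2.2 a b
      (mem_splits.mp hx).1 (mem_splits.mp hx).2, ← Finset.mul_sum]
    simp only [defectG, co_sub, co_add, co_ofNat_mul, co_zero] at h
    simp only [co_mul] at h
    rw [Finset.sum_sub_distrib, Finset.sum_add_distrib, ← Finset.mul_sum, h, mul_zero,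
      Int.cast_zero]
  rec4 a b hab := recFour_quadricN hab

theorem IsQuadricCount.eq_quadricN (h : IsQuadricCount N) : N = quadricN := by
  refine eq_of_recFour (fun a b hab => ?_) h.zero_zero h.rec4 (fun a b => recFour_quadricN)
  have : (a = 0 ∧ b = 0) ∨ (a = 0 ∧ b = 1) ∨ (a = 1 ∧ b = 0) := by omega
  rcases this with ⟨rfl, rfl⟩ | ⟨rfl, rfl⟩ | ⟨rfl, rfl⟩
  · rw [h.zero_zero, quadricN_zero]
  · rw [h.zero_one, quadricN_one rfl]
  · rw [h.symm, h.zero_one, quadricN_one rfl]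

end FrobeniusMfd
namespace FrobeniusMfd

/-! ### Summation over the bidegrees of a given total degree -/

theorem sum_splits_eq {A : Type*} [AddCommMonoid A] (n : ℕ) (F : ℕ → ℕ → ℕ → ℕ → A) :
    ∑ x ∈ Finset.HasAntidiagonal.antidiagonal n, ∑ y ∈ splits x.1 x.2,
      F y.1.1 y.2.1 y.1.2 y.2.2 =
    ∑ z ∈ Finset.HasAntidiagonal.antidiagonal n,
      ∑ u ∈ Finset.HasAntidiagonal.antidiagonal z.1,
        ∑ v ∈ Finset.HasAntidiagonal.antidiagonal z.2, F u.1 u.2 v.1 v.2 := by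
  simp only [← Finset.sum_product']
  rw [Finset.sum_sigma', Finset.sum_sigma']
  refine Finset.sum_nbij'
    (fun x => ⟨(x.2.1.1 + x.2.2.1, x.2.1.2 + x.2.2.2),
      ((x.2.1.1, x.2.2.1), (x.2.1.2, x.2.2.2))⟩)
    (fun x => ⟨(x.2.1.1 + x.2.2.1, x.2.1.2 + x.2.2.2),
      ((x.2.1.1, x.2.2.1), (x.2.1.2, x.2.2.2))⟩) ?_ ?_ ?_ ?_ ?_
  · rintro ⟨⟨a, b⟩, ⟨⟨p, q⟩, ⟨r, s⟩⟩⟩ h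
    simp [splits] at h ⊢; omega
  · rintro ⟨⟨a, b⟩, ⟨⟨p, q⟩, ⟨r, s⟩⟩⟩ h
    simp [splits] at h ⊢; omega
  · rintro ⟨⟨a, b⟩, ⟨⟨p, q⟩, ⟨r, s⟩⟩⟩ h
    simp [splits] at h ⊢; omega
  · rintro ⟨⟨a, b⟩, ⟨⟨p, q⟩, ⟨r, s⟩⟩⟩ h
    simp [splits] at h ⊢; omega
  · rintro ⟨⟨a, b⟩, ⟨⟨p, q⟩, ⟨r, s⟩⟩⟩ h
    rfl

/-- Setting both variables equal. -/
noncomputable def contract (f : DPS) : PowerSeries ℚ :=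
  PowerSeries.mk fun n => ∑ x ∈ Finset.HasAntidiagonal.antidiagonal n, co x.1 x.2 f

theorem coeff_contract (n : ℕ) (f : DPS) : PowerSeries.coeff n (contract f) =
    ∑ x ∈ Finset.HasAntidiagonal.antidiagonal n, co x.1 x.2 f := by simp [contract]

theorem contract_mul (f g : DPS) : contract (f * g) = contract f * contract g := by
  ext n
  simp only [PowerSeries.coeff_mul, coeff_contract, co_mul, Finset.sum_mul_sum]
  exact sum_splits_eq n fun a₁ b₁ a₂ b₂ => co a₁ b₁ f * co a₂ b₂ g

theorem contract_add (f g : DPS) : contract (f + g) = contract f + contract g := by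
  ext n; simp [coeff_contract, Finset.sum_add_distrib]

theorem contract_sub (f g : DPS) : contract (f - g) = contract f - contract g := by
  ext n; simp [coeff_contract, Finset.sum_sub_distrib]

theorem contract_zero : contract 0 = 0 := by
  ext n; simp [coeff_contract]

theorem contract_two_mul (f : DPS) : contract (2 * f) = 2 * contract f := by
  rw [two_mul, contract_add, two_mul]

theorem potCoeff_quadricN_symm (a b : ℕ) :
    potCoeff quadricN a b = potCoeff quadricN b a := by
  rw [potCoeff, potCoeff, quadricN_symm, add_comm a b]

theorem co_qjet_symm (i j k a b : ℕ) : co a b (qjet i j k) = co b a (qjet j i k) := by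
  rw [co_jet, co_jet, potCoeff_quadricN_symm, add_comm a b]; ring

theorem contract_qjet_symm (i j k : ℕ) : contract (qjet i j k) = contract (qjet j i k) := by
  ext n
  rw [coeff_contract, coeff_contract, ← Finset.Nat.sum_antidiagonal_swap]
  exact Finset.sum_congr rfl fun x _ => co_qjet_symm _ _ _ _ _

theorem contractedN_eq (n : ℕ) : contractedN n =
    ∑ x ∈ Finset.HasAntidiagonal.antidiagonal n, quadricN x.1 x.2 := by
  rw [← Finset.Nat.sum_antidiagonal_swap]
  exact (Finset.Nat.sum_antidiagonal_eq_sum_range_succ (fun i j => quadricN j i) n).symm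

/-- The coefficients `N_n / (2n-1)!` of the contracted prepotential. -/
noncomputable def contractedCoeff (n : ℕ) : ℚ := contractedN n / ((2 * n - 1).factorial : ℚ)

theorem contractedCoeff_eq (n : ℕ) : contractedCoeff n =
    ∑ x ∈ Finset.HasAntidiagonal.antidiagonal n, potCoeff quadricN x.1 x.2 := by
  rw [contractedCoeff, contractedN_eq, Int.cast_sum, Finset.sum_div]
  refine Finset.sum_congr rfl fun x hx => ?_
  rw [potCoeff, Finset.HasAntidiagonal.mem_antidiagonal.mp hx]

/-- The third derivatives of the contracted prepotential. -/
noncomputable def contractedJet (i k : ℕ) : PowerSeries ℚ :=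
  PowerSeries.mk fun n => (n : ℚ) ^ i * fallingProd n k * contractedCoeff n

theorem contractedJet_eq_contract (i k : ℕ) (f : DPS)
    (h : ∀ a b, co a b f = ((a + b : ℕ) : ℚ) ^ i * fallingProd (a + b) k * potCoeff quadricN a b) :
    contractedJet i k = contract f := by
  ext n
  rw [coeff_contract, contractedJet, PowerSeries.coeff_mk, contractedCoeff_eq, Finset.mul_sum]
  refine Finset.sum_congr rfl fun x hx => ?_
  rw [h, Finset.HasAntidiagonal.mem_antidiagonal.mp hx]

theorem contractedJet_eq : contractedJet 0 3 =
    (4⁻¹ : ℚ) • (contractedJet 2 1 * contractedJet 2 1 - contractedJet 3 0 * contractedJet 1 2) := by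
  have e03 : contractedJet 0 3 = contract (qjet 0 0 3) :=
    contractedJet_eq_contract 0 3 _ fun a b => by rw [co_jet]; ring
  have e21 : contractedJet 2 1 = 2 * contract (qjet 2 0 1) + 2 * contract (qjet 1 1 1) := by
    rw [contractedJet_eq_contract 2 1 (qjet 2 0 1 + 2 * qjet 1 1 1 + qjet 0 2 1) fun a b => by
      simp only [co_add, co_ofNat_mul, co_jet]; push_cast; ring]
    rw [contract_add, contract_add, contract_two_mul, contract_qjet_symm 0 2 1]; ring
  have e30 : contractedJet 3 0 = 2 * contract (qjet 3 0 0) + 6 * contract (qjet 2 1 0) := by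
    rw [contractedJet_eq_contract 3 0 (qjet 3 0 0 + (2 * qjet 2 1 0 + qjet 2 1 0)
      + (2 * qjet 1 2 0 + qjet 1 2 0) + qjet 0 3 0) fun a b => by
      simp only [co_add, co_ofNat_mul, co_jet]; push_cast; ring]
    simp only [contract_add, contract_two_mul, contract_qjet_symm 0 3 0, contract_qjet_symm 1 2 0]
    ring
  have e12 : contractedJet 1 2 = 2 * contract (qjet 1 0 2) := by
    rw [contractedJet_eq_contract 1 2 (qjet 1 0 2 + qjet 0 1 2) fun a b => by
      simp only [co_add, co_ofNat_mul, co_jet]; push_cast; ring]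
    rw [contract_add, contract_qjet_symm 0 1 2]; ring
  have hD := congrArg contract defectD_quadricN
  have hG := congrArg contract defects_quadricN.2.2.2.1
  simp only [defectD, defectG, contract_add, contract_sub, contract_zero,
    contract_two_mul] at hD hG
  simp only [contract_mul, contract_qjet_symm 0 3 0, contract_qjet_symm 1 2 0,
    contract_qjet_symm 0 2 1, contract_qjet_symm 0 1 2] at hD hG
  have h4 : (4 : ℚ) • contractedJet 0 3 =
      contractedJet 2 1 * contractedJet 2 1 - contractedJet 3 0 * contractedJet 1 2 := by
    rw [Algebra.smul_def, map_ofNat, e03, e21, e30, e12]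
    linear_combination 4 * hD + 4 * hG
  rw [← h4, smul_smul]; norm_num

theorem contractedN_one : contractedN 1 = 2 := by
  rw [contractedN_eq]
  simp [Finset.Nat.antidiagonal_succ, quadricN_one]

theorem contractedCoeff_rec (n : ℕ) : fallingProd n 3 * contractedCoeff n =
    1 / 4 * ∑ p ∈ Finset.HasAntidiagonal.antidiagonal n,
      (p.1 : ℚ) * p.2 * (p.1 * p.2 * (n + 1) - (p.1 ^ 2 + p.2 ^ 2)) *
        (contractedCoeff p.1 * contractedCoeff p.2) := by
  have h := congrArg (PowerSeries.coeff n) contractedJet_eq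
  rw [map_smul, map_sub, PowerSeries.coeff_mul, PowerSeries.coeff_mul, smul_eq_mul,
    ← Finset.sum_sub_distrib] at h
  simp only [contractedJet, PowerSeries.coeff_mk, pow_zero, one_mul] at h
  rw [h, one_div]
  congr 1
  rw [← mul_right_inj' (two_ne_zero : (2 : ℚ) ≠ 0)]
  conv_lhs => rw [two_mul]; rw (occs := .pos [1]) [← Finset.Nat.sum_antidiagonal_swap]
  rw [← Finset.sum_add_distrib, Finset.mul_sum]
  refine Finset.sum_congr rfl fun x hx => ?_
  simp only [← Finset.HasAntidiagonal.mem_antidiagonal.mp hx, fallingProd_succ, fallingProd_zero, Prod.fst_swap,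
    Prod.snd_swap]
  push_cast
  ring

theorem contractedN_rec (n : ℕ) (hn : 2 ≤ n) : (contractedN n : ℚ) =
    1 / 4 * ((2 * n - 4).factorial : ℚ) *
      ∑ p ∈ (Finset.HasAntidiagonal.antidiagonal n).filter (fun p => 1 ≤ p.1 ∧ 1 ≤ p.2),
        (p.1 : ℚ) * p.2 * (p.1 * p.2 * (n + 1) - (p.1 ^ 2 + p.2 ^ 2)) *
            contractedN p.1 * contractedN p.2 /
          (((2 * p.1 - 1).factorial : ℚ) * ((2 * p.2 - 1).factorial : ℚ)) := by
  have e : (contractedN n : ℚ) = ((2 * n - 4).factorial : ℚ) *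
      (fallingProd n 3 * contractedCoeff n) := by
    obtain ⟨k, rfl⟩ : ∃ k, n = k + 2 := ⟨n - 2, by omega⟩
    rw [contractedCoeff, show 2 * (k + 2) - 4 = 2 * k by omega,
      show 2 * (k + 2) - 1 = 2 * k + 1 + 1 + 1 by omega, Nat.factorial_succ, Nat.factorial_succ,
      Nat.factorial_succ]
    simp only [fallingProd_zero, fallingProd_succ]
    push_cast
    field_simp
    ring
  rw [e, contractedCoeff_rec, Finset.sum_filter, ← mul_assoc, mul_comm (1 / 4 : ℚ)]
  congr 1
  refine Finset.sum_congr rfl fun x hx => ?_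
  split_ifs with h
  · rw [contractedCoeff, contractedCoeff]; ring
  · have : x.1 = 0 ∨ x.2 = 0 := by omega
    rcases this with h | h <;> simp [h]

/-! ### Growth of the coefficients -/

theorem sum_abs_bound_of_rec {h : ℕ → ℝ} (hn : ∀ n, 0 ≤ h n) {C K : ℝ} (hK : 0 ≤ K)
    (h1 : h 1 ≤ C)
    (hr : ∀ n, h (n + 2) ≤ K * ∑ x ∈ Finset.HasAntidiagonal.antidiagonal n,
      h (x.1 + 1) * h (x.2 + 1)) (n : ℕ) : h (n + 1) ≤ K ^ n * C ^ (n + 1) * catalan n := by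
  have hC : 0 ≤ C := (hn 1).trans h1
  induction n using Nat.strong_induction_on with
  | _ n ih =>
    rcases n with _ | n
    · simpa using h1
    refine (hr n).trans ?_
    rw [catalan_succ', Nat.cast_sum, Finset.mul_sum, Finset.mul_sum]
    refine Finset.sum_le_sum fun x hx => ?_
    have hx := Finset.HasAntidiagonal.mem_antidiagonal.mp hx
    have := mul_le_mul (ih x.1 (by omega)) (ih x.2 (by omega)) (hn _) (by positivity)
    calc K * (h (x.1 + 1) * h (x.2 + 1)) ≤ _ := mul_le_mul_of_nonneg_left this hK
      _ = _ := by rw [← hx]; push_cast; ring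

theorem catalan_le_four_pow (n : ℕ) : catalan n ≤ 4 ^ n := by
  rw [catalan_eq_centralBinom_div]
  refine (Nat.div_le_self _ _).trans ?_
  rw [Nat.centralBinom, show 4 = 2 ^ 2 by rfl, ← pow_mul]
  exact Nat.choose_le_two_pow _ _

theorem abs_co_qjet_le {i j k : ℕ} (h : i + j + k = 3) (hk : k ≤ 2) (a b : ℕ) :
    |co a b (qjet i j k)| ≤ 4 * (((a + b : ℕ) : ℚ) ^ 3 * |potCoeff quadricN a b|) := by
  rw [co_jet, abs_mul, ← mul_assoc]
  rcases Nat.eq_zero_or_pos (a + b) with h0 | h0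
  · obtain ⟨rfl, rfl⟩ : a = 0 ∧ b = 0 := by omega
    simp [potCoeff_zero quadricN_zero]
  refine mul_le_mul_of_nonneg_right ?_ (abs_nonneg _)
  have hn : (1 : ℚ) ≤ ((a + b : ℕ) : ℚ) := by exact_mod_cast h0
  have ha : (a : ℚ) ≤ ((a + b : ℕ) : ℚ) := by push_cast; linarith [b.cast_nonneg (α := ℚ)]
  have hb : (b : ℚ) ≤ ((a + b : ℕ) : ℚ) := by push_cast; linarith [a.cast_nonneg (α := ℚ)]
  have hf : 0 ≤ fallingProd (a + b) k ∧
      fallingProd (a + b) k ≤ 4 * ((a + b : ℕ) : ℚ) ^ k := by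
    generalize ((a + b : ℕ)) = n at hn
    interval_cases k <;> simp only [fallingProd_zero, fallingProd_succ] <;> push_cast <;>
    constructor <;> nlinarith
  have hp := pow_le_pow_left₀ (Nat.cast_nonneg a) ha i
  have hq := pow_le_pow_left₀ (Nat.cast_nonneg b) hb j
  rw [abs_of_nonneg (mul_nonneg (by positivity) hf.1)]
  calc _ ≤ ((a + b : ℕ) : ℚ) ^ i * ((a + b : ℕ) : ℚ) ^ j * (4 * ((a + b : ℕ) : ℚ) ^ k) :=
        mul_le_mul (mul_le_mul hp hq (by positivity) (by positivity)) hf.2 hf.1 (by positivity)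
    _ = 4 * ((a + b : ℕ) : ℚ) ^ (i + j + k) := by ring
    _ = _ := by rw [h]

/-- The weighted size `n³ ∑_{a+b=n} |N_{ab}| / (2n-1)!`. -/
noncomputable def coeffSize (n : ℕ) : ℚ := ∑ x ∈ Finset.HasAntidiagonal.antidiagonal n,
  ((x.1 + x.2 : ℕ) : ℚ) ^ 3 * |potCoeff quadricN x.1 x.2|

theorem coeffSize_rec (n : ℕ) : coeffSize (n + 2) ≤ 128 *
    ∑ x ∈ Finset.HasAntidiagonal.antidiagonal n, coeffSize (x.1 + 1) * coeffSize (x.2 + 1) := by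
  have h0 : coeffSize 0 = 0 := by simp [coeffSize]
  have hpt : ∀ a b, a + b = n + 2 → ((a + b : ℕ) : ℚ) ^ 3 * |potCoeff quadricN a b| ≤
      ∑ x ∈ splits a b, 128 * (((x.1.1 + x.2.1 : ℕ) : ℚ) ^ 3 *
        |potCoeff quadricN x.1.1 x.2.1| * (((x.1.2 + x.2.2 : ℕ) : ℚ) ^ 3 *
          |potCoeff quadricN x.1.2 x.2.2|)) := by
    intro a b hab
    have hD := congrArg (co a b) defectD_quadricN
    simp only [defectD, co_sub, co_add, co_zero] at hD
    have hD' : co a b (jet (potCoeff quadricN) 0 0 3) = ∑ x ∈ splits a b,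
        (co x.1.1 x.2.1 (qjet 1 1 1) * co x.1.2 x.2.2 (qjet 1 1 1) +
        co x.1.1 x.2.1 (qjet 2 0 1) * co x.1.2 x.2.2 (qjet 0 2 1) -
        co x.1.1 x.2.1 (qjet 1 0 2) * co x.1.2 x.2.2 (qjet 1 2 0) -
        co x.1.1 x.2.1 (qjet 0 1 2) * co x.1.2 x.2.2 (qjet 2 1 0)) := by
      simp only [Finset.sum_sub_distrib, Finset.sum_add_distrib, ← co_mul]
      linear_combination hD
    have hf : ((a + b : ℕ) : ℚ) ^ 3 ≤ 2 * fallingProd (a + b) 3 := by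
      rw [hab]
      simp only [fallingProd_zero, fallingProd_succ]
      push_cast
      have := n.cast_nonneg (α := ℚ)
      nlinarith [mul_nonneg this this, mul_nonneg this (mul_nonneg this this)]
    have hf' : |fallingProd (a + b) 3| = fallingProd (a + b) 3 :=
      abs_of_nonneg (by nlinarith [pow_nonneg ((a + b).cast_nonneg (α := ℚ)) 3])
    have hl : ((a + b : ℕ) : ℚ) ^ 3 * |potCoeff quadricN a b| ≤
        2 * |co a b (jet (potCoeff quadricN) 0 0 3)| := by
      rw [co_jet, pow_zero, pow_zero, one_mul, one_mul, abs_mul, ← mul_assoc, hf']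
      exact mul_le_mul_of_nonneg_right hf (abs_nonneg _)
    refine hl.trans ?_
    rw [hD']
    refine (mul_le_mul_of_nonneg_left (Finset.abs_sum_le_sum_abs _ _) zero_le_two).trans ?_
    rw [Finset.mul_sum]
    refine Finset.sum_le_sum fun x _ => ?_
    set P := ((x.1.1 + x.2.1 : ℕ) : ℚ) ^ 3 * |potCoeff quadricN x.1.1 x.2.1|
    set Q := ((x.1.2 + x.2.2 : ℕ) : ℚ) ^ 3 * |potCoeff quadricN x.1.2 x.2.2|
    have hb : ∀ i j k i' j' k', i + j + k = 3 → k ≤ 2 → i' + j' + k' = 3 → k' ≤ 2 →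
        |co x.1.1 x.2.1 (qjet i j k) * co x.1.2 x.2.2 (qjet i' j' k')| ≤ 16 * (P * Q) := by
      intro i j k i' j' k' h1 h2 h3 h4
      rw [abs_mul]
      refine (mul_le_mul (abs_co_qjet_le h1 h2 _ _) (abs_co_qjet_le h3 h4 _ _) (abs_nonneg _)
        (by positivity)).trans (le_of_eq ?_)
      ring
    have b1 := abs_le.mp (hb 1 1 1 1 1 1 rfl (by norm_num) rfl (by norm_num))
    have b2 := abs_le.mp (hb 2 0 1 0 2 1 rfl (by norm_num) rfl (by norm_num))
    have b3 := abs_le.mp (hb 1 0 2 1 2 0 rfl (by norm_num) rfl (by norm_num))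
    have b4 := abs_le.mp (hb 0 1 2 2 1 0 rfl (by norm_num) rfl (by norm_num))
    have : |_| ≤ 64 * (P * Q) := abs_le.mpr
      (⟨by linarith [b1.1, b2.1, b3.2, b4.2], by linarith [b1.2, b2.2, b3.1, b4.1]⟩ :
        -(64 * (P * Q)) ≤ co x.1.1 x.2.1 (qjet 1 1 1) * co x.1.2 x.2.2 (qjet 1 1 1) +
        co x.1.1 x.2.1 (qjet 2 0 1) * co x.1.2 x.2.2 (qjet 0 2 1) -
        co x.1.1 x.2.1 (qjet 1 0 2) * co x.1.2 x.2.2 (qjet 1 2 0) -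
        co x.1.1 x.2.1 (qjet 0 1 2) * co x.1.2 x.2.2 (qjet 2 1 0) ∧ _)
    linarith
  calc coeffSize (n + 2) ≤ _ := Finset.sum_le_sum fun x hx =>
        hpt x.1 x.2 (Finset.HasAntidiagonal.mem_antidiagonal.mp hx)
    _ = 128 * ∑ z ∈ Finset.HasAntidiagonal.antidiagonal (n + 2),
        coeffSize z.1 * coeffSize z.2 := by
      simp only [coeffSize, Finset.sum_mul_sum]
      simp only [Finset.mul_sum]
      exact sum_splits_eq (n + 2) fun a₁ b₁ a₂ b₂ => 128 * (((a₁ + b₁ : ℕ) : ℚ) ^ 3 *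
        |potCoeff quadricN a₁ b₁| * (((a₂ + b₂ : ℕ) : ℚ) ^ 3 * |potCoeff quadricN a₂ b₂|))
    _ = _ := by
      rw [Finset.Nat.antidiagonal_succ_succ']
      simp [h0]

theorem coeffSize_nonneg (n : ℕ) : 0 ≤ coeffSize n :=
  Finset.sum_nonneg fun _ _ => by positivity

/-- The numbers `N_{ab} / (2(a+b)-1)!` grow at most exponentially. -/
theorem abs_potCoeff_le (a b : ℕ) :
    |((potCoeff quadricN a b : ℚ) : ℝ)| ≤ 1024 ^ (a + b) := by
  rcases Nat.eq_zero_or_pos (a + b) with h | h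
  · obtain ⟨rfl, rfl⟩ : a = 0 ∧ b = 0 := by omega
    simp [potCoeff_zero quadricN_zero]
  obtain ⟨n, hn⟩ : ∃ n, a + b = n + 1 := ⟨a + b - 1, by omega⟩
  have h1 : coeffSize 1 = 2 := by
    simp [coeffSize, Finset.Nat.antidiagonal_succ, potCoeff, quadricN_one]; norm_num
  have := sum_abs_bound_of_rec (h := fun n => (coeffSize n : ℝ)) (C := 2) (K := 128)
    (fun n => by exact_mod_cast coeffSize_nonneg n) (by norm_num) (by simp [h1])
    (fun n => by exact_mod_cast coeffSize_rec n) n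
  have h2 : |potCoeff quadricN a b| ≤ coeffSize (n + 1) := by
    have h3 := Finset.single_le_sum (f := fun x : ℕ × ℕ =>
      ((x.1 + x.2 : ℕ) : ℚ) ^ 3 * |potCoeff quadricN x.1 x.2|)
      (s := Finset.HasAntidiagonal.antidiagonal (n + 1))
      (fun _ _ => by positivity) (Finset.HasAntidiagonal.mem_antidiagonal.mpr hn : (a, b) ∈ _)
    refine le_trans ?_ h3
    refine le_mul_of_one_le_left (abs_nonneg _) (one_le_pow₀ ?_)
    exact_mod_cast h
  have h4 : (catalan n : ℝ) ≤ 4 ^ n := by exact_mod_cast catalan_le_four_pow n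
  calc |((potCoeff quadricN a b : ℚ) : ℝ)| ≤ (coeffSize (n + 1) : ℝ) := by exact_mod_cast h2
    _ ≤ 128 ^ n * 2 ^ (n + 1) * catalan n := this
    _ ≤ 128 ^ n * 2 ^ (n + 1) * 4 ^ n := by gcongr
    _ = 2 * 1024 ^ n := by
      rw [pow_succ, show (1024 : ℝ) = 128 * 2 * 4 by norm_num, mul_pow, mul_pow]; ring
    _ ≤ 1024 ^ (a + b) := by rw [hn, pow_succ]; nlinarith [pow_pos (show (0:ℝ) < 1024 by norm_num) n]

end FrobeniusMfd
namespace FrobeniusMfd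

/-! ### Exponential series attached to formal series -/

theorem norm_exp_le {𝕜 : Type*} [RCLike 𝕜] (w : 𝕜) : ‖NormedSpace.exp w‖ ≤ Real.exp ‖w‖ := by
  rw [Real.exp_eq_exp_ℝ]
  refine (NormedSpace.expSeries_div_hasSum_exp w).norm_le_of_bounded
    (NormedSpace.expSeries_div_hasSum_exp ‖w‖) fun n => ?_
  rw [norm_div, norm_pow, RCLike.norm_natCast]

theorem norm_exp_ofReal {𝕜 : Type*} [RCLike 𝕜] (r : ℝ) :
    ‖NormedSpace.exp (r : 𝕜)‖ = Real.exp r := by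
  have := NormedSpace.algebraMap_exp_comm (𝔸 := 𝕜) r
  rw [← Real.exp_eq_exp_ℝ, RCLike.algebraMap_eq_ofReal] at this
  rw [← this, RCLike.norm_ofReal, abs_of_pos (Real.exp_pos r)]

theorem exp_add' {𝕜 : Type*} [RCLike 𝕜] (x y : 𝕜) :
    NormedSpace.exp (x + y) = NormedSpace.exp x * NormedSpace.exp y := by
  have : NormedAlgebra ℚ 𝕜 := NormedAlgebra.restrictScalars ℚ ℝ 𝕜
  exact NormedSpace.exp_add

section
variable {𝕜 : Type*} [RCLike 𝕜]

/-- The summand `c_{ab} t₄^{2(a+b)-s} e^{a t₂ + b t₃}` for a formal series with coefficients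
`c_{ab}`. -/
noncomputable def evTerm (f : DPS) (s : ℕ) (t : Fin 4 → 𝕜) (p : ℕ × ℕ) : 𝕜 :=
  (co p.1 p.2 f : 𝕜) * t 3 ^ (2 * (p.1 + p.2) - s) *
    NormedSpace.exp ((p.1 : 𝕜) * t 1 + (p.2 : 𝕜) * t 2)

/-- The sum of `c_{ab} t₄^{2(a+b)-s} e^{a t₂ + b t₃}`. -/
noncomputable def ev (f : DPS) (s : ℕ) (t : Fin 4 → 𝕜) : 𝕜 := ∑' p, evTerm f s t p

theorem evTerm_add (f g : DPS) (s : ℕ) (t : Fin 4 → 𝕜) (p : ℕ × ℕ) :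
    evTerm (f + g) s t p = evTerm f s t p + evTerm g s t p := by
  simp only [evTerm, co_add]; push_cast; ring

theorem evTerm_sub (f g : DPS) (s : ℕ) (t : Fin 4 → 𝕜) (p : ℕ × ℕ) :
    evTerm (f - g) s t p = evTerm f s t p - evTerm g s t p := by
  simp only [evTerm, co_sub]; push_cast; ring

theorem evTerm_two_mul (f : DPS) (s : ℕ) (t : Fin 4 → 𝕜) (p : ℕ × ℕ) :
    evTerm (2 * f) s t p = 2 * evTerm f s t p := by
  rw [two_mul, evTerm_add, two_mul]

theorem quadricTerm_eq (t : Fin 4 → 𝕜) (p : ℕ × ℕ) :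
    quadricTerm t p = evTerm (qjet 0 0 0) 1 t p := by
  simp only [quadricTerm, evTerm, co_jet, potCoeff, fallingProd_zero]; push_cast; ring

/-- The coefficients are bounded by those of the prepotential up to a polynomial factor. -/
def Dominated (f : DPS) : Prop := ∃ (C : ℝ) (D : ℕ), 0 ≤ C ∧ ∀ a b,
  |((co a b f : ℚ) : ℝ)| ≤ C * (((a + b : ℕ) : ℝ) + 1) ^ D * |((potCoeff quadricN a b : ℚ) : ℝ)|

theorem Dominated.of_factor {f g : DPS} (hf : Dominated f) {C : ℝ} {D : ℕ} (hC : 0 ≤ C)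
    (h : ∀ a b, |((co a b g : ℚ) : ℝ)| ≤
      C * (((a + b : ℕ) : ℝ) + 1) ^ D * |((co a b f : ℚ) : ℝ)|) : Dominated g := by
  obtain ⟨C', D', hC', h'⟩ := hf
  refine ⟨C * C', D + D', by positivity, fun a b => (h a b).trans ?_⟩
  calc _ ≤ C * (((a + b : ℕ) : ℝ) + 1) ^ D * (C' * (((a + b : ℕ) : ℝ) + 1) ^ D' *
        |((potCoeff quadricN a b : ℚ) : ℝ)|) := mul_le_mul_of_nonneg_left (h' a b) (by positivity)
    _ = _ := by ring

/-- The coefficientwise counterpart of `∂/∂t₄` on series with exponents `2(a+b)-s`. -/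
noncomputable def dz (f : DPS) (s : ℕ) : DPS :=
  dps fun a b => ((2 * (a + b) - s : ℕ) : ℚ) * co a b f

theorem Dominated.fst {f : DPS} (hf : Dominated f) : Dominated (eulerFst f) := by
  refine hf.of_factor (C := 1) (D := 1) zero_le_one fun a b => ?_
  rw [co_eulerFst]; push_cast
  rw [abs_mul, Nat.abs_cast]
  refine mul_le_mul_of_nonneg_right ?_ (abs_nonneg _)
  linarith [b.cast_nonneg (α := ℝ)]

theorem Dominated.snd {f : DPS} (hf : Dominated f) : Dominated (eulerSnd f) := by
  refine hf.of_factor (C := 1) (D := 1) zero_le_one fun a b => ?_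
  rw [co_eulerSnd]; push_cast
  rw [abs_mul, Nat.abs_cast]
  refine mul_le_mul_of_nonneg_right ?_ (abs_nonneg _)
  linarith [a.cast_nonneg (α := ℝ)]

theorem Dominated.dz {f : DPS} (hf : Dominated f) (s : ℕ) : Dominated (dz f s) := by
  refine hf.of_factor (C := 2) (D := 1) zero_le_two fun a b => ?_
  rw [FrobeniusMfd.dz, co_dps, Rat.cast_mul, Rat.cast_natCast, abs_mul, Nat.abs_cast]
  refine mul_le_mul_of_nonneg_right ?_ (abs_nonneg _)
  have : ((2 * (a + b) - s : ℕ) : ℝ) ≤ ((2 * (a + b) : ℕ) : ℝ) := by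
    exact_mod_cast Nat.sub_le _ _
  push_cast at this ⊢
  linarith

theorem dominated_qjet_zero : Dominated (qjet 0 0 0) :=
  ⟨1, 0, zero_le_one, fun a b => by rw [co_jet]; simp⟩

/-- Raising the modulus of a number by a small amount. -/
theorem exists_norm_add (z : 𝕜) {δ : ℝ} (hδ : 0 < δ) :
    ∃ w : 𝕜, ‖w - z‖ = δ ∧ ‖w‖ = ‖z‖ + δ := by
  rcases eq_or_ne z 0 with rfl | hz
  · exact ⟨(δ : 𝕜), by simp [abs_of_pos hδ], by simp [abs_of_pos hδ]⟩
  have hz' : 0 < ‖z‖ := norm_pos_iff.mpr hz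
  refine ⟨z + ((δ / ‖z‖ : ℝ) : 𝕜) * z, ?_, ?_⟩
  · rw [add_sub_cancel_left, norm_mul, RCLike.norm_ofReal, abs_of_pos (by positivity)]
    field_simp
  · have : z + ((δ / ‖z‖ : ℝ) : 𝕜) * z = ((1 + δ / ‖z‖ : ℝ) : 𝕜) * z := by push_cast; ring
    rw [this, norm_mul, RCLike.norm_ofReal, abs_of_pos (by positivity)]
    field_simp

theorem pow_le_mul_exp (D : ℕ) {δ : ℝ} (hδ : 0 < δ) :
    ∃ B : ℝ, 0 ≤ B ∧ ∀ n : ℕ, ((n : ℝ) + 1) ^ D ≤ B * Real.exp (n * δ) := by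
  refine ⟨D.factorial * Real.exp δ / δ ^ D, by positivity, fun n => ?_⟩
  have h := Real.pow_div_factorial_le_exp (((n : ℝ) + 1) * δ) (by positivity) D
  rw [div_le_iff₀ (by positivity), mul_pow, add_mul, one_mul, Real.exp_add] at h
  rw [div_mul_eq_mul_div, le_div_iff₀ (by positivity)]
  linarith

theorem pow_sub_le {r : ℝ} (hr : 0 < r) {s : ℕ} (hs : 1 ≤ s) (n : ℕ) :
    r ^ (n - s) ≤ max 1 r⁻¹ ^ s * r ^ (n - 1) := by
  have h1 : n - 1 = (n - s) + ((n - 1) - (n - s)) := by omega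
  have h2 : (n - 1) - (n - s) ≤ s := by omega
  have h3 : (1 : ℝ) ≤ max 1 r⁻¹ := le_max_left _ _
  rw [h1]
  set j := (n - 1) - (n - s)
  calc r ^ (n - s) = (r⁻¹ ^ j * r ^ j) * r ^ (n - s) := by
        rw [← mul_pow, inv_mul_cancel₀ hr.ne', one_pow, one_mul]
    _ ≤ (max 1 r⁻¹ ^ s * r ^ j) * r ^ (n - s) := by
        have : r⁻¹ ^ j ≤ max 1 r⁻¹ ^ s :=
          (pow_le_pow_left₀ (by positivity) (le_max_right _ _) j).trans (pow_le_pow_right₀ h3 h2)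
        gcongr
    _ = _ := by rw [pow_add]; ring

theorem isOpen_quadricRegion : IsOpen (quadricRegion 𝕜) := isOpen_interior

theorem summable_of_mem {t : Fin 4 → 𝕜} (ht : t ∈ quadricRegion 𝕜) :
    Summable (quadricTerm t) :=
  interior_subset (s := {t | Summable (quadricTerm t)}) ht

theorem norm_exp_perturb (a b : ℕ) {x y x' y' : 𝕜} {ε : ℝ} (hx : ‖x' - x‖ ≤ ε)
    (hy : ‖y' - y‖ ≤ ε) : ‖NormedSpace.exp ((a : 𝕜) * x' + b * y')‖ ≤
      ‖NormedSpace.exp ((a : 𝕜) * x + b * y)‖ * Real.exp (((a + b : ℕ) : ℝ) * ε) := by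
  have : (a : 𝕜) * x' + b * y' = (a * x + b * y) + (a * (x' - x) + b * (y' - y)) := by ring
  rw [this, exp_add', norm_mul]
  refine mul_le_mul_of_nonneg_left ((norm_exp_le _).trans (Real.exp_le_exp.mpr ?_)) (norm_nonneg _)
  refine (norm_add_le _ _).trans ?_
  rw [norm_mul, norm_mul, RCLike.norm_natCast, RCLike.norm_natCast]
  push_cast
  nlinarith [mul_le_mul_of_nonneg_left hx (a.cast_nonneg (α := ℝ)),
    mul_le_mul_of_nonneg_left hy (b.cast_nonneg (α := ℝ))]

/-- Near each point of the region, series with dominated coefficients converge normally. -/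
theorem exists_majorant {t₀ : Fin 4 → 𝕜} (ht₀ : t₀ ∈ quadricRegion 𝕜) :
    ∃ ε > 0, ∀ f, Dominated f → ∀ s, 1 ≤ s → ∃ u : ℕ × ℕ → ℝ, Summable u ∧
      ∀ t ∈ Metric.ball t₀ ε, ∀ p, ‖evTerm f s t p‖ ≤ u p := by
  obtain ⟨ε, hε, hball⟩ := Metric.isOpen_iff.mp isOpen_quadricRegion t₀ ht₀
  set δ := ε / 2 with hδ'
  have hδ : 0 < δ := by positivity
  obtain ⟨w, hw1, hw2⟩ := exists_norm_add (t₀ 3) hδ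
  set q : Fin 4 → 𝕜 := ![t₀ 0, t₀ 1 + (δ : 𝕜), t₀ 2 + (δ : 𝕜), w] with hq
  have hqU : q ∈ quadricRegion 𝕜 := by
    refine hball (Metric.mem_ball.mpr (lt_of_le_of_lt ?_ (show δ < ε by linarith)))
    rw [dist_pi_le_iff hδ.le]
    intro i
    fin_cases i <;> simp [hq, dist_eq_norm, hw1, abs_of_pos hδ, hδ.le]
  have hsum := (summable_of_mem hqU).norm
  set r := ‖t₀ 3‖ + δ with hr'
  have hr : 0 < r := by positivity
  have hterm : ∀ p : ℕ × ℕ, ‖quadricTerm q p‖ = |((potCoeff quadricN p.1 p.2 : ℚ) : ℝ)| *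
      r ^ (2 * (p.1 + p.2) - 1) * (Real.exp (((p.1 + p.2 : ℕ) : ℝ) * δ) *
        ‖NormedSpace.exp ((p.1 : 𝕜) * t₀ 1 + (p.2 : 𝕜) * t₀ 2)‖) := by
    intro p
    have e : (p.1 : 𝕜) * q 1 + (p.2 : 𝕜) * q 2 =
        ((((p.1 + p.2 : ℕ) : ℝ) * δ : ℝ) : 𝕜) + ((p.1 : 𝕜) * t₀ 1 + (p.2 : 𝕜) * t₀ 2) := by
      have e1 : q 1 = t₀ 1 + (δ : 𝕜) := rfl
      have e2 : q 2 = t₀ 2 + (δ : 𝕜) := rfl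
      rw [e1, e2]; push_cast; ring
    rw [quadricTerm_eq, evTerm, norm_mul, norm_mul, norm_pow, e, exp_add', norm_mul,
      norm_exp_ofReal, co_jet]
    have h3 : q 3 = w := rfl
    have hc : ∀ c : ℚ, ‖(c : 𝕜)‖ = |(c : ℝ)| := fun c => by
      rw [← RCLike.ofReal_ratCast, RCLike.norm_ofReal]
    rw [h3, hw2, hc]; simp
  refine ⟨δ / 2, by positivity, fun f hf s hs => ?_⟩
  obtain ⟨C, D, hC, hCD⟩ := hf
  obtain ⟨B, hB, hBD⟩ := pow_le_mul_exp D (half_pos hδ)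
  refine ⟨fun p => C * max 1 r⁻¹ ^ s * B * ‖quadricTerm q p‖, hsum.mul_left _, fun t ht p => ?_⟩
  have hd : ∀ i, ‖t i - t₀ i‖ ≤ δ / 2 := fun i => by
    rw [← dist_eq_norm]
    exact (dist_le_pi_dist t t₀ i).trans (Metric.mem_ball.mp ht).le
  have hz : ‖t 3‖ ≤ r := by
    have := norm_le_insert' (t 3) (t₀ 3)
    linarith [hd 3]
  have hc : ∀ c : ℚ, ‖(c : 𝕜)‖ = |(c : ℝ)| := fun c => by
    rw [← RCLike.ofReal_ratCast, RCLike.norm_ofReal]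
  have h4 := pow_sub_le hr hs (2 * (p.1 + p.2))
  have h5 := hBD (p.1 + p.2)
  set n : ℕ := p.1 + p.2
  set E := ‖NormedSpace.exp ((p.1 : 𝕜) * t₀ 1 + (p.2 : 𝕜) * t₀ 2)‖
  set M := |((potCoeff quadricN p.1 p.2 : ℚ) : ℝ)|
  have hexp : Real.exp ((n : ℝ) * (δ / 2)) * Real.exp ((n : ℝ) * (δ / 2)) =
      Real.exp ((n : ℝ) * δ) := by rw [← Real.exp_add]; ring_nf
  calc ‖evTerm f s t p‖ = |((co p.1 p.2 f : ℚ) : ℝ)| * ‖t 3‖ ^ (2 * n - s) *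
        ‖NormedSpace.exp ((p.1 : 𝕜) * t 1 + (p.2 : 𝕜) * t 2)‖ := by
        rw [evTerm, norm_mul, norm_mul, norm_pow, hc]
    _ ≤ (C * ((n : ℝ) + 1) ^ D * M) * r ^ (2 * n - s) *
        (E * Real.exp ((n : ℝ) * (δ / 2))) := by
        refine mul_le_mul (mul_le_mul (hCD _ _) (pow_le_pow_left₀ (norm_nonneg _) hz _)
          (by positivity) (by positivity)) (norm_exp_perturb _ _ (hd 1) (hd 2)) (norm_nonneg _)
          (by positivity)
    _ ≤ (C * (B * Real.exp ((n : ℝ) * (δ / 2))) * M) * (max 1 r⁻¹ ^ s * r ^ (2 * n - 1)) *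
        (E * Real.exp ((n : ℝ) * (δ / 2))) := by gcongr
    _ = C * max 1 r⁻¹ ^ s * B * (M * r ^ (2 * n - 1) *
        ((Real.exp ((n : ℝ) * (δ / 2)) * Real.exp ((n : ℝ) * (δ / 2))) * E)) := by ring
    _ = C * max 1 r⁻¹ ^ s * B * ‖quadricTerm q p‖ := by rw [hexp, hterm]

theorem summable_evTerm {t : Fin 4 → 𝕜} (ht : t ∈ quadricRegion 𝕜) {f : DPS} (hf : Dominated f)
    {s : ℕ} (hs : 1 ≤ s) : Summable fun p => ‖evTerm f s t p‖ := by
  obtain ⟨ε, hε, h⟩ := exists_majorant ht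
  obtain ⟨u, hu, hb⟩ := h f hf s hs
  exact hu.of_nonneg_of_le (fun _ => norm_nonneg _) (hb t (Metric.mem_ball_self hε))

theorem hasSum_ev {t : Fin 4 → 𝕜} (ht : t ∈ quadricRegion 𝕜) {f : DPS} (hf : Dominated f)
    {s : ℕ} (hs : 1 ≤ s) : HasSum (evTerm f s t) (ev f s t) :=
  (summable_evTerm ht hf hs).of_norm.hasSum

/-- The coordinate functional. -/
noncomputable abbrev coord (𝕜 : Type*) [RCLike 𝕜] (i : Fin 4) : (Fin 4 → 𝕜) →L[𝕜] 𝕜 := ContinuousLinearMap.proj i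

theorem hasFDerivAt_evTerm (f : DPS) (s : ℕ) (p : ℕ × ℕ) (t : Fin 4 → 𝕜) :
    HasFDerivAt (fun t => evTerm f s t p)
      (evTerm (eulerFst f) s t p • coord 𝕜 1 + evTerm (eulerSnd f) s t p • coord 𝕜 2 +
        evTerm (dz f s) (s + 1) t p • coord 𝕜 3) t := by
  have hl : HasFDerivAt (fun t : Fin 4 → 𝕜 => (p.1 : 𝕜) * t 1 + (p.2 : 𝕜) * t 2)
      ((p.1 : 𝕜) • coord 𝕜 1 + (p.2 : 𝕜) • coord 𝕜 2) t :=
    ((hasFDerivAt_apply 1 t).const_mul _).add ((hasFDerivAt_apply 2 t).const_mul _)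
  have he := (_root_.hasDerivAt_exp (𝕂 := 𝕜)
    (x := (p.1 : 𝕜) * t 1 + (p.2 : 𝕜) * t 2)).comp_hasFDerivAt t hl
  have hz := ((hasDerivAt_pow (2 * (p.1 + p.2) - s) (t 3)).comp_hasFDerivAt t
    (hasFDerivAt_apply (𝕜 := 𝕜) 3 t)).const_mul (co p.1 p.2 f : 𝕜)
  refine (hz.mul he).congr_fderiv ?_
  ext v
  simp only [evTerm, co_eulerFst, co_eulerSnd, dz, co_dps, Function.comp, Nat.sub_sub]
  push_cast
  simp
  ring

theorem hasFDerivAt_ev {t : Fin 4 → 𝕜} (ht : t ∈ quadricRegion 𝕜) {f : DPS} (hf : Dominated f)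
    {s : ℕ} (hs : 1 ≤ s) : HasFDerivAt (ev f s : (Fin 4 → 𝕜) → 𝕜)
      (ev (eulerFst f) s t • coord 𝕜 1 + ev (eulerSnd f) s t • coord 𝕜 2 +
        ev (dz f s) (s + 1) t • coord 𝕜 3) t := by
  obtain ⟨ε, hε, h⟩ := exists_majorant ht
  obtain ⟨u₁, hu₁, hb₁⟩ := h _ hf.fst s hs
  obtain ⟨u₂, hu₂, hb₂⟩ := h _ hf.snd s hs
  obtain ⟨u₃, hu₃, hb₃⟩ := h _ (hf.dz s) (s + 1) (by omega)
  have hn : ∀ i, ‖coord 𝕜 i‖ ≤ 1 := fun i =>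
    ContinuousLinearMap.opNorm_le_bound _ zero_le_one fun v => by
      rw [one_mul]; exact norm_le_pi_norm v i
  have hle : ∀ (c : 𝕜) (i : Fin 4), ‖c • coord 𝕜 i‖ ≤ ‖c‖ := fun c i => by
    rw [norm_smul]; exact mul_le_of_le_one_right (norm_nonneg _) (hn i)
  have key := hasFDerivAt_tsum_of_isPreconnected ((hu₁.add hu₂).add hu₃) Metric.isOpen_ball
    (convex_ball t ε).isPreconnected (fun p x _ => hasFDerivAt_evTerm f s p x)
    (fun p x hx => (norm_add₃_le).trans (add_le_add_three ((hle _ _).trans (hb₁ x hx p))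
      ((hle _ _).trans (hb₂ x hx p)) ((hle _ _).trans (hb₃ x hx p))))
    (Metric.mem_ball_self hε) (summable_evTerm ht hf hs).of_norm (Metric.mem_ball_self hε)
  refine key.congr_fderiv ?_
  exact ((((hasSum_ev ht hf.fst hs).smul_const _).add
    ((hasSum_ev ht hf.snd hs).smul_const _)).add
    ((hasSum_ev ht (hf.dz s) (by omega)).smul_const _)).tsum_eq

theorem contDiffOn_ev {f : DPS} (hf : Dominated f) {s : ℕ} (hs : 1 ≤ s) :
    ContDiffOn 𝕜 ∞ (ev f s : (Fin 4 → 𝕜) → 𝕜) (quadricRegion 𝕜) := by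
  rw [contDiffOn_infty]
  intro n
  induction n generalizing f s with
  | zero =>
    exact contDiffOn_zero.mpr fun t ht => (hasFDerivAt_ev ht hf hs).continuousAt.continuousWithinAt
  | succ n ih =>
    rw [Nat.cast_succ, contDiffOn_succ_iff_fderiv_of_isOpen isOpen_quadricRegion]
    refine ⟨fun t ht => (hasFDerivAt_ev ht hf hs).differentiableAt.differentiableWithinAt,
      fun h => absurd h (by simp), ?_⟩
    refine ContDiffOn.congr (((ih hf.fst hs).smul contDiffOn_const).add
      ((ih hf.snd hs).smul contDiffOn_const) |>.add
      ((ih (hf.dz s) (by omega)).smul contDiffOn_const)) fun t ht => (hasFDerivAt_ev ht hf hs).fderiv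

/-- The exponents `2(a+b)-s` of the series are honest. -/
def SuppGE (s : ℕ) (f : DPS) : Prop := ∀ a b, 2 * (a + b) < s → co a b f = 0

theorem evTerm_mul {f g : DPS} {s s' : ℕ} (hf : SuppGE s f) (hg : SuppGE s' g) (t : Fin 4 → 𝕜)
    (p : ℕ × ℕ) : evTerm (f * g) (s + s') t p =
      ∑ x ∈ splits p.1 p.2, evTerm f s t (x.1.1, x.2.1) * evTerm g s' t (x.1.2, x.2.2) := by
  rw [evTerm, co_mul, Rat.cast_sum, Finset.sum_mul, Finset.sum_mul]
  refine Finset.sum_congr rfl fun x hx => ?_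
  obtain ⟨h1, h2⟩ := mem_splits.mp hx
  simp only [evTerm]
  by_cases c1 : 2 * (x.1.1 + x.2.1) < s
  · simp [hf _ _ c1]
  by_cases c2 : 2 * (x.1.2 + x.2.2) < s'
  · simp [hg _ _ c2]
  have e1 : 2 * (p.1 + p.2) - (s + s') =
      (2 * (x.1.1 + x.2.1) - s) + (2 * (x.1.2 + x.2.2) - s') := by omega
  have e2 : (p.1 : 𝕜) * t 1 + p.2 * t 2 =
      (x.1.1 * t 1 + x.2.1 * t 2) + (x.1.2 * t 1 + x.2.2 * t 2) := by
    rw [← h1, ← h2]; push_cast; ring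
  rw [e1, e2, exp_add', pow_add]
  push_cast
  ring

theorem hasSum_ev_mul {t : Fin 4 → 𝕜} (ht : t ∈ quadricRegion 𝕜) {f g : DPS} (hf : Dominated f)
    (hg : Dominated g) {s s' : ℕ} (hs : 1 ≤ s) (hs' : 1 ≤ s') (hfs : SuppGE s f)
    (hgs : SuppGE s' g) : HasSum (evTerm (f * g) (s + s') t) (ev f s t * ev g s' t) := by
  have h := (hasSum_ev ht hf hs).mul (hasSum_ev ht hg hs')
    (summable_mul_of_summable_norm (summable_evTerm ht hf hs) (summable_evTerm ht hg hs'))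
  have h2 := (Equiv.prodProdProdComm ℕ ℕ ℕ ℕ).hasSum_iff.mpr h
  have h3 := h2.tsum_fiberwise (fun x => (x.1.1 + x.1.2, x.2.1 + x.2.2))
  refine (congrArg (fun F => HasSum F _) (funext fun p => ?_)).mpr h3
  rw [evTerm_mul hfs hgs]
  have : (fun x : (ℕ × ℕ) × (ℕ × ℕ) => (x.1.1 + x.1.2, x.2.1 + x.2.2)) ⁻¹' {p} =
      (splits p.1 p.2 : Set ((ℕ × ℕ) × (ℕ × ℕ))) := by
    ext x
    simp [mem_splits, Prod.ext_iff]
  rw [this, Finset.tsum_subtype' (splits p.1 p.2)]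
  rfl

end

end FrobeniusMfd
namespace FrobeniusMfd

/-! ### The third derivatives of the prepotential -/

theorem fallingProd_eq_zero {n k : ℕ} (hn : 1 ≤ n) (h : 2 * n < k + 1) : fallingProd n k = 0 := by
  rw [fallingProd]
  refine Finset.prod_eq_zero (i := 2 * n - 1) (Finset.mem_range.mpr (by omega)) ?_
  rw [Nat.cast_sub (by omega)]; push_cast; ring

theorem suppGE_qjet (i j k : ℕ) : SuppGE (k + 1) (qjet i j k) := fun a b h => by
  rcases Nat.eq_zero_or_pos (a + b) with h0 | h0
  · exact vanishBelow_jet (potCoeff_zero quadricN_zero) i j k a b (by omega)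
  · rw [co_jet, fallingProd_eq_zero h0 h]; ring

theorem dz_qjet (i j k : ℕ) : dz (qjet i j k) (k + 1) = qjet i j (k + 1) :=
  dps_ext fun a b => by
    rw [dz, co_dps]
    by_cases h : 2 * (a + b) < k + 1
    · rw [suppGE_qjet i j k a b h, suppGE_qjet i j (k + 1) a b (by omega), mul_zero]
    · rw [co_jet, co_jet, Nat.cast_sub (by omega), fallingProd_succ]; push_cast; ring

theorem dominated_qjet (i j k : ℕ) : Dominated (qjet i j k) := by
  induction i with
  | succ i ih => rw [qjet, ← eulerFst_jet]; exact ih.fst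
  | zero =>
    induction j with
    | succ j ih => rw [qjet, ← eulerSnd_jet]; exact ih.snd
    | zero =>
      induction k with
      | succ k ih => rw [← dz_qjet]; exact ih.dz _
      | zero => exact dominated_qjet_zero

section
variable {𝕜 : Type*} [RCLike 𝕜]

/-- The derivative `∂₂ⁱ ∂₃ʲ ∂₄ᵏ Φ` of the quantum part of the prepotential. -/
noncomputable def qPhi (i j k : ℕ) (t : Fin 4 → 𝕜) : 𝕜 := ev (qjet i j k) (k + 1) t

theorem hasSum_qPhi {t : Fin 4 → 𝕜} (ht : t ∈ quadricRegion 𝕜) (i j k : ℕ) :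
    HasSum (evTerm (qjet i j k) (k + 1) t) (qPhi i j k t) :=
  hasSum_ev ht (dominated_qjet i j k) (by omega)

theorem hasSum_qPhi_mul {t : Fin 4 → 𝕜} (ht : t ∈ quadricRegion 𝕜) (i j k i' j' k' : ℕ) :
    HasSum (evTerm (qjet i j k * qjet i' j' k') (k + k' + 2) t)
      (qPhi i j k t * qPhi i' j' k' t) := by
  have := hasSum_ev_mul ht (dominated_qjet i j k) (dominated_qjet i' j' k')
    (s := k + 1) (s' := k' + 1) (by omega) (by omega) (suppGE_qjet i j k) (suppGE_qjet i' j' k')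
  rwa [show k + 1 + (k' + 1) = k + k' + 2 by ring] at this

theorem eq_zero_of_hasSum_evTerm_zero {s : ℕ} {t : Fin 4 → 𝕜} {f : DPS} {x : 𝕜} (hf : f = 0)
    (h : HasSum (evTerm f s t) x) : x = 0 := by
  subst hf
  refine h.unique ?_
  have : evTerm (0 : DPS) s t = fun _ => 0 := funext fun p => by simp [evTerm]
  rw [this]
  exact hasSum_zero

/-- The associativity equations for the quantum part of the prepotential. -/
structure QuadricWDVV (t : Fin 4 → 𝕜) : Prop where
  eqA : qPhi 3 0 0 t * qPhi 0 3 0 t - qPhi 2 1 0 t * qPhi 1 2 0 t - 2 * qPhi 1 1 1 t = 0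
  eqB : qPhi 3 0 0 t * qPhi 0 2 1 t - qPhi 1 2 0 t * qPhi 2 0 1 t - qPhi 1 0 2 t = 0
  eqB' : qPhi 0 3 0 t * qPhi 2 0 1 t - qPhi 2 1 0 t * qPhi 0 2 1 t - qPhi 0 1 2 t = 0
  eqG : qPhi 3 0 0 t * qPhi 0 1 2 t + qPhi 2 1 0 t * qPhi 1 0 2 t
    - 2 * (qPhi 2 0 1 t * qPhi 1 1 1 t) = 0
  eqG' : qPhi 0 3 0 t * qPhi 1 0 2 t + qPhi 1 2 0 t * qPhi 0 1 2 t
    - 2 * (qPhi 0 2 1 t * qPhi 1 1 1 t) = 0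
  eqD : qPhi 0 0 3 t + qPhi 1 0 2 t * qPhi 1 2 0 t + qPhi 0 1 2 t * qPhi 2 1 0 t
    - qPhi 1 1 1 t * qPhi 1 1 1 t - qPhi 2 0 1 t * qPhi 0 2 1 t = 0

theorem quadricWDVV {t : Fin 4 → 𝕜} (ht : t ∈ quadricRegion 𝕜) : QuadricWDVV t := by
  have h := hasSum_qPhi ht
  have hm := hasSum_qPhi_mul ht
  obtain ⟨hA, hB, hB', hG, hG'⟩ := defects_quadricN
  have two : ∀ {f : DPS} {s : ℕ} {x : 𝕜}, HasSum (evTerm f s t) x →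
      HasSum (evTerm (2 * f) s t) (2 * x) := fun {f s x} hx => by
    have := hx.mul_left 2
    rwa [← show evTerm (2 * f) s t = _ from funext (evTerm_two_mul f s t)] at this
  have add : ∀ {f g : DPS} {s : ℕ} {x y : 𝕜}, HasSum (evTerm f s t) x → HasSum (evTerm g s t) y →
      HasSum (evTerm (f + g) s t) (x + y) := fun {f g s x y} hx hy => by
    have := hx.add hy
    rwa [← show evTerm (f + g) s t = _ from funext (evTerm_add f g s t)] at this
  have sub : ∀ {f g : DPS} {s : ℕ} {x y : 𝕜}, HasSum (evTerm f s t) x → HasSum (evTerm g s t) y →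
      HasSum (evTerm (f - g) s t) (x - y) := fun {f g s x y} hx hy => by
    have := hx.sub hy
    rwa [← show evTerm (f - g) s t = _ from funext (evTerm_sub f g s t)] at this
  exact ⟨eq_zero_of_hasSum_evTerm_zero hA
      (sub (sub (hm 3 0 0 0 3 0) (hm 2 1 0 1 2 0)) (two (h 1 1 1))),
    eq_zero_of_hasSum_evTerm_zero hB (sub (sub (hm 3 0 0 0 2 1) (hm 1 2 0 2 0 1)) (h 1 0 2)),
    eq_zero_of_hasSum_evTerm_zero hB' (sub (sub (hm 0 3 0 2 0 1) (hm 2 1 0 0 2 1)) (h 0 1 2)),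
    eq_zero_of_hasSum_evTerm_zero hG
      (sub (add (hm 3 0 0 0 1 2) (hm 2 1 0 1 0 2)) (two (hm 2 0 1 1 1 1))),
    eq_zero_of_hasSum_evTerm_zero hG'
      (sub (add (hm 0 3 0 1 0 2) (hm 1 2 0 0 1 2)) (two (hm 0 2 1 1 1 1))),
    eq_zero_of_hasSum_evTerm_zero defectD_quadricN
      (sub (sub (add (add (h 0 0 3) (hm 1 0 2 1 2 0)) (hm 0 1 2 2 1 0)) (hm 1 1 1 1 1 1))
        (hm 2 0 1 0 2 1))⟩

/-- `f` has partial derivatives `v` at `t`, and is differentiable there. -/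
def HasPd (f : (Fin 4 → 𝕜) → 𝕜) (t v : Fin 4 → 𝕜) : Prop :=
  HasFDerivAt f (∑ i, v i • coord 𝕜 i) t

theorem HasPd.pd_eq {f : (Fin 4 → 𝕜) → 𝕜} {t v : Fin 4 → 𝕜} (h : HasPd f t v) (i : Fin 4) :
    pd i f t = v i := by
  rw [pd, HasFDerivAt.fderiv h]
  simp [Pi.single_apply]

theorem HasPd.congr {f : (Fin 4 → 𝕜) → 𝕜} {t v w : Fin 4 → 𝕜} (h : HasPd f t v) (e : v = w) :
    HasPd f t w := e ▸ h

theorem HasPd.congr_of_eqOn {f g : (Fin 4 → 𝕜) → 𝕜} {t v : Fin 4 → 𝕜} {U : Set (Fin 4 → 𝕜)}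
    (h : HasPd f t v) (hU : IsOpen U) (ht : t ∈ U) (e : ∀ x ∈ U, g x = f x) : HasPd g t v :=
  HasFDerivAt.congr_of_eventuallyEq h (Filter.eventually_of_mem (hU.mem_nhds ht) e)

theorem HasPd.add {f g : (Fin 4 → 𝕜) → 𝕜} {t v w : Fin 4 → 𝕜} (hf : HasPd f t v)
    (hg : HasPd g t w) : HasPd (fun t => f t + g t) t (v + w) :=
  (HasFDerivAt.add hf hg).congr_fderiv (by
    ext u; simp [add_mul, Finset.sum_add_distrib])

theorem HasPd.mul {f g : (Fin 4 → 𝕜) → 𝕜} {t v w : Fin 4 → 𝕜} (hf : HasPd f t v)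
    (hg : HasPd g t w) : HasPd (fun t => f t * g t) t (f t • w + g t • v) :=
  (HasFDerivAt.mul hf hg).congr_fderiv (by
    ext u; simp [add_mul, Finset.sum_add_distrib, Finset.mul_sum, mul_assoc])

theorem hasPd_const (c : 𝕜) (t : Fin 4 → 𝕜) : HasPd (fun _ => c) t 0 :=
  (hasFDerivAt_const c t).congr_fderiv (by ext u; simp)

theorem hasPd_coord (i : Fin 4) (t : Fin 4 → 𝕜) : HasPd (fun t => t i) t (Pi.single i 1) :=
  (hasFDerivAt_apply i t).congr_fderiv (by
    ext v
    fin_cases i <;> simp [Fin.sum_univ_four])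

theorem hasPd_qPhi {t : Fin 4 → 𝕜} (ht : t ∈ quadricRegion 𝕜) (i j k : ℕ) :
    HasPd (qPhi i j k) t ![0, qPhi (i + 1) j k t, qPhi i (j + 1) k t, qPhi i j (k + 1) t] := by
  refine (hasFDerivAt_ev ht (dominated_qjet i j k) (s := k + 1) (by omega)).congr_fderiv ?_
  rw [eulerFst_jet, eulerSnd_jet, dz_qjet, Fin.sum_univ_four]
  ext v
  simp [qPhi]

theorem quadricF_eq (t : Fin 4 → 𝕜) :
    quadricF t = 1 / 2 * t 0 ^ 2 * t 3 + t 0 * t 1 * t 2 + qPhi 0 0 0 t := by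
  simp only [quadricF, quadricTerm_eq]; rfl

/-- First derivatives of the prepotential. -/
noncomputable def quadricGrad (t : Fin 4 → 𝕜) : Fin 4 → 𝕜 :=
  ![t 0 * t 3 + t 1 * t 2, t 0 * t 2 + qPhi 1 0 0 t, t 0 * t 1 + qPhi 0 1 0 t,
    1 / 2 * (t 0 * t 0) + qPhi 0 0 1 t]

/-- Second derivatives of the prepotential. -/
noncomputable def quadricHess (t : Fin 4 → 𝕜) : Fin 4 → Fin 4 → 𝕜 :=
  ![![t 3, t 2, t 1, t 0],
    ![t 2, qPhi 2 0 0 t, t 0 + qPhi 1 1 0 t, qPhi 1 0 1 t],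
    ![t 1, t 0 + qPhi 1 1 0 t, qPhi 0 2 0 t, qPhi 0 1 1 t],
    ![t 0, qPhi 1 0 1 t, qPhi 0 1 1 t, qPhi 0 0 2 t]]

/-- Third derivatives of the prepotential. -/
noncomputable def quadricThird (t : Fin 4 → 𝕜) : Fin 4 → Fin 4 → Fin 4 → 𝕜 :=
  ![![![0, 0, 0, 1], ![0, 0, 1, 0], ![0, 1, 0, 0], ![1, 0, 0, 0]],
    ![![0, 0, 1, 0], ![0, qPhi 3 0 0 t, qPhi 2 1 0 t, qPhi 2 0 1 t],
      ![1, qPhi 2 1 0 t, qPhi 1 2 0 t, qPhi 1 1 1 t], ![0, qPhi 2 0 1 t, qPhi 1 1 1 t, qPhi 1 0 2 t]],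
    ![![0, 1, 0, 0], ![1, qPhi 2 1 0 t, qPhi 1 2 0 t, qPhi 1 1 1 t],
      ![0, qPhi 1 2 0 t, qPhi 0 3 0 t, qPhi 0 2 1 t], ![0, qPhi 1 1 1 t, qPhi 0 2 1 t, qPhi 0 1 2 t]],
    ![![1, 0, 0, 0], ![0, qPhi 2 0 1 t, qPhi 1 1 1 t, qPhi 1 0 2 t],
      ![0, qPhi 1 1 1 t, qPhi 0 2 1 t, qPhi 0 1 2 t], ![0, qPhi 1 0 2 t, qPhi 0 1 2 t, qPhi 0 0 3 t]]]

theorem hasPd_quadricF {t : Fin 4 → 𝕜} (ht : t ∈ quadricRegion 𝕜) :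
    HasPd quadricF t (quadricGrad t) := by
  have h0 := hasPd_coord 0 t
  have h : HasPd (fun t : Fin 4 → 𝕜 => 1 / 2 * (t 0 * t 0) * t 3 + t 0 * t 1 * t 2 + qPhi 0 0 0 t)
      t _ := (((((hasPd_const (1 / 2) t).mul (h0.mul h0)).mul (hasPd_coord 3 t)).add
    ((h0.mul (hasPd_coord 1 t)).mul (hasPd_coord 2 t)))).add (hasPd_qPhi ht 0 0 0)
  have e : (quadricF : (Fin 4 → 𝕜) → 𝕜) =
      fun t => 1 / 2 * (t 0 * t 0) * t 3 + t 0 * t 1 * t 2 + qPhi 0 0 0 t := by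
    funext t; rw [quadricF_eq]; ring
  rw [e]
  refine h.congr ?_
  funext i
  fin_cases i <;> simp [quadricGrad] <;> ring

theorem hasPd_quadricGrad {t : Fin 4 → 𝕜} (ht : t ∈ quadricRegion 𝕜) (k : Fin 4) :
    HasPd (fun t => quadricGrad t k) t (fun j => quadricHess t j k) := by
  have h := fun i => hasPd_coord (𝕜 := 𝕜) i t
  fin_cases k
  · refine (((h 0).mul (h 3)).add ((h 1).mul (h 2))).congr ?_
    funext i; fin_cases i <;> simp [quadricHess]
  · refine (((h 0).mul (h 2)).add (hasPd_qPhi ht 1 0 0)).congr ?_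
    funext i; fin_cases i <;> simp [quadricHess]
  · refine (((h 0).mul (h 1)).add (hasPd_qPhi ht 0 1 0)).congr ?_
    funext i; fin_cases i <;> simp [quadricHess]
  · refine (((hasPd_const (1 / 2) t).mul ((h 0).mul (h 0))).add (hasPd_qPhi ht 0 0 1)).congr ?_
    funext i; fin_cases i <;> simp [quadricHess]
    ring

theorem hasPd_quadricHess {t : Fin 4 → 𝕜} (ht : t ∈ quadricRegion 𝕜) (j k : Fin 4) :
    HasPd (fun t => quadricHess t j k) t (fun i => quadricThird t i j k) := by
  have h := fun i => hasPd_coord (𝕜 := 𝕜) i t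
  have q := hasPd_qPhi ht
  fin_cases j <;> fin_cases k
  · exact (h 3).congr (by funext i; fin_cases i <;> simp [quadricThird])
  · exact (h 2).congr (by funext i; fin_cases i <;> simp [quadricThird])
  · exact (h 1).congr (by funext i; fin_cases i <;> simp [quadricThird])
  · exact (h 0).congr (by funext i; fin_cases i <;> simp [quadricThird])
  · exact (h 2).congr (by funext i; fin_cases i <;> simp [quadricThird])
  · exact (q 2 0 0).congr (by funext i; fin_cases i <;> simp [quadricThird])
  · exact ((h 0).add (q 1 1 0)).congr (by funext i; fin_cases i <;> simp [quadricThird])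
  · exact (q 1 0 1).congr (by funext i; fin_cases i <;> simp [quadricThird])
  · exact (h 1).congr (by funext i; fin_cases i <;> simp [quadricThird])
  · exact ((h 0).add (q 1 1 0)).congr (by funext i; fin_cases i <;> simp [quadricThird])
  · exact (q 0 2 0).congr (by funext i; fin_cases i <;> simp [quadricThird])
  · exact (q 0 1 1).congr (by funext i; fin_cases i <;> simp [quadricThird])
  · exact (h 0).congr (by funext i; fin_cases i <;> simp [quadricThird])
  · exact (q 1 0 1).congr (by funext i; fin_cases i <;> simp [quadricThird])
  · exact (q 0 1 1).congr (by funext i; fin_cases i <;> simp [quadricThird])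
  · exact (q 0 0 2).congr (by funext i; fin_cases i <;> simp [quadricThird])

theorem pd_quadricF {t : Fin 4 → 𝕜} (ht : t ∈ quadricRegion 𝕜) (k : Fin 4) :
    pd k quadricF t = quadricGrad t k := (hasPd_quadricF ht).pd_eq k

theorem hasPd_pd_quadricF {t : Fin 4 → 𝕜} (ht : t ∈ quadricRegion 𝕜) (k : Fin 4) :
    HasPd (pd k quadricF) t (fun j => quadricHess t j k) :=
  (hasPd_quadricGrad ht k).congr_of_eqOn isOpen_quadricRegion ht fun _ hx => pd_quadricF hx k

theorem hasPd_pd_pd_quadricF {t : Fin 4 → 𝕜} (ht : t ∈ quadricRegion 𝕜) (j k : Fin 4) :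
    HasPd (pd j (pd k quadricF)) t (fun i => quadricThird t i j k) :=
  (hasPd_quadricHess ht j k).congr_of_eqOn isOpen_quadricRegion ht
    fun _ hx => (hasPd_pd_quadricF hx k).pd_eq j

theorem c3_quadricF {t : Fin 4 → 𝕜} (ht : t ∈ quadricRegion 𝕜) (i j k : Fin 4) :
    c3 quadricF i j k t = quadricThird t i j k := (hasPd_pd_pd_quadricF ht j k).pd_eq i

theorem metric_quadricF {t : Fin 4 → 𝕜} (ht : t ∈ quadricRegion 𝕜) :
    metric quadricF t = antidiagonal 4 := by
  ext i j
  rw [metric, Matrix.of_apply, c3_quadricF ht, antidiagonal, Matrix.of_apply]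
  fin_cases i <;> fin_cases j <;> simp [quadricThird]

theorem antidiagonal_mul_self (m : ℕ) :
    (antidiagonal m : Matrix (Fin m) (Fin m) 𝕜) * antidiagonal m = 1 := by
  ext i j
  rw [Matrix.mul_apply, Finset.sum_eq_single (Fin.rev i)]
  · simp only [antidiagonal, Matrix.of_apply, Fin.val_rev, Matrix.one_apply, Fin.ext_iff]
    rw [if_pos (by omega), one_mul]
    congr 1
    simp only [eq_iff_iff]; omega
  · intro k _ hk
    rw [antidiagonal, Matrix.of_apply, if_neg, zero_mul]
    intro h
    apply hk
    rw [Fin.ext_iff, Fin.val_rev]; omega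
  · simp

theorem antidiagonal_inv (m : ℕ) :
    (antidiagonal m : Matrix (Fin m) (Fin m) 𝕜)⁻¹ = antidiagonal m :=
  Matrix.inv_eq_left_inv (antidiagonal_mul_self m)

theorem isUnit_det_antidiagonal (m : ℕ) :
    IsUnit (antidiagonal m : Matrix (Fin m) (Fin m) 𝕜).det :=
  (Matrix.isUnit_iff_isUnit_det _).mp
    (IsUnit.of_mul_eq_one _ (antidiagonal_mul_self m))

theorem sum_antidiagonal_mul (m : ℕ) (k : Fin m) (f : Fin m → 𝕜) :
    ∑ l, (antidiagonal m : Matrix (Fin m) (Fin m) 𝕜) k l * f l = f (Fin.rev k) := by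
  rw [Finset.sum_eq_single (Fin.rev k)]
  · rw [antidiagonal, Matrix.of_apply, if_pos (by rw [Fin.val_rev]; omega), one_mul]
  · intro l _ hl
    rw [antidiagonal, Matrix.of_apply, if_neg, zero_mul]
    intro h
    apply hl
    rw [Fin.ext_iff, Fin.val_rev]; omega
  · simp

theorem circ_quadricF {t : Fin 4 → 𝕜} (ht : t ∈ quadricRegion 𝕜) (a b : Fin 4 → 𝕜) :
    circ quadricF t a b = fun k => ∑ i, ∑ j, quadricThird t i j (Fin.rev k) * a i * b j := by
  funext k
  simp only [circ, structFun, metric_quadricF ht, antidiagonal_inv, sum_antidiagonal_mul,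
    c3_quadricF ht]

/-- The multiplication in coordinates. -/
theorem circ_quadricF_eq {t : Fin 4 → 𝕜} (ht : t ∈ quadricRegion 𝕜) (a b : Fin 4 → 𝕜) :
    circ quadricF t a b =
      ![a 0 * b 0 + qPhi 2 0 1 t * (a 1 * b 1) + qPhi 1 1 1 t * (a 1 * b 2 + a 2 * b 1)
          + qPhi 0 2 1 t * (a 2 * b 2) + qPhi 1 0 2 t * (a 1 * b 3 + a 3 * b 1)
          + qPhi 0 1 2 t * (a 2 * b 3 + a 3 * b 2) + qPhi 0 0 3 t * (a 3 * b 3),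
        a 0 * b 1 + a 1 * b 0 + qPhi 2 1 0 t * (a 1 * b 1) + qPhi 1 2 0 t * (a 1 * b 2 + a 2 * b 1)
          + qPhi 0 3 0 t * (a 2 * b 2) + qPhi 1 1 1 t * (a 1 * b 3 + a 3 * b 1)
          + qPhi 0 2 1 t * (a 2 * b 3 + a 3 * b 2) + qPhi 0 1 2 t * (a 3 * b 3),
        a 0 * b 2 + a 2 * b 0 + qPhi 3 0 0 t * (a 1 * b 1) + qPhi 2 1 0 t * (a 1 * b 2 + a 2 * b 1)
          + qPhi 1 2 0 t * (a 2 * b 2) + qPhi 2 0 1 t * (a 1 * b 3 + a 3 * b 1)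
          + qPhi 1 1 1 t * (a 2 * b 3 + a 3 * b 2) + qPhi 1 0 2 t * (a 3 * b 3),
        a 0 * b 3 + a 3 * b 0 + a 1 * b 2 + a 2 * b 1] := by
  rw [circ_quadricF ht]
  funext k
  fin_cases k <;> simp [Fin.sum_univ_four, quadricThird, Fin.rev] <;> ring

end

end FrobeniusMfd
namespace FrobeniusMfd

section
variable {𝕜 : Type*} [RCLike 𝕜]

/-! ### The Frobenius manifold structure on the region -/

theorem circ_quadricF_comm {t : Fin 4 → 𝕜} (ht : t ∈ quadricRegion 𝕜) (a b : Fin 4 → 𝕜) :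
    circ quadricF t a b = circ quadricF t b a := by
  rw [circ_quadricF_eq ht, circ_quadricF_eq ht]
  funext k
  fin_cases k <;> simp <;> ring

theorem one_circ_quadricF {t : Fin 4 → 𝕜} (ht : t ∈ quadricRegion 𝕜) (a : Fin 4 → 𝕜) :
    circ quadricF t (Pi.single 0 1) a = a := by
  rw [circ_quadricF_eq ht]
  funext k
  fin_cases k <;> simp

theorem circ_quadricF_assoc {t : Fin 4 → 𝕜} (ht : t ∈ quadricRegion 𝕜) (a b c : Fin 4 → 𝕜) :
    circ quadricF t (circ quadricF t a b) c = circ quadricF t a (circ quadricF t b c) := by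
  obtain ⟨hA, hB, hB', hG, hG', hD⟩ := quadricWDVV ht
  simp only [circ_quadricF_eq ht]
  generalize qPhi 3 0 0 t = x30 at *
  generalize qPhi 2 1 0 t = x21 at *
  generalize qPhi 1 2 0 t = x12 at *
  generalize qPhi 0 3 0 t = x03 at *
  generalize qPhi 2 0 1 t = y20 at *
  generalize qPhi 1 1 1 t = y11 at *
  generalize qPhi 0 2 1 t = y02 at *
  generalize qPhi 1 0 2 t = z1 at *
  generalize qPhi 0 1 2 t = z0 at *
  generalize qPhi 0 0 3 t = w at *
  funext k
  fin_cases k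
  · simp
    linear_combination b 1 * ((a 1 * c 2 - a 2 * c 1) * hB + (a 1 * c 3 - a 3 * c 1) * hG
      + (a 2 * c 3 - a 3 * c 2) * hD) + b 2 * (-(a 1 * c 2 - a 2 * c 1) * hB'
      + (a 1 * c 3 - a 3 * c 1) * hD + (a 2 * c 3 - a 3 * c 2) * hG')
  · simp
    linear_combination b 1 * ((a 1 * c 2 - a 2 * c 1) * hA + (a 1 * c 3 - a 3 * c 1) * hB
      - (a 2 * c 3 - a 3 * c 2) * hB') - b 3 * (-(a 1 * c 2 - a 2 * c 1) * hB'
      + (a 1 * c 3 - a 3 * c 1) * hD + (a 2 * c 3 - a 3 * c 2) * hG')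
  · simp
    linear_combination -b 2 * ((a 1 * c 2 - a 2 * c 1) * hA + (a 1 * c 3 - a 3 * c 1) * hB
      - (a 2 * c 3 - a 3 * c 2) * hB') - b 3 * ((a 1 * c 2 - a 2 * c 1) * hB
      + (a 1 * c 3 - a 3 * c 1) * hG + (a 2 * c 3 - a 3 * c 2) * hD)
  · simp
    ring

theorem contDiffOn_quadricF :
    ContDiffOn 𝕜 ∞ (quadricF : (Fin 4 → 𝕜) → 𝕜) (quadricRegion 𝕜) := by
  have e : (quadricF : (Fin 4 → 𝕜) → 𝕜) =
      fun t => 1 / 2 * t 0 ^ 2 * t 3 + t 0 * t 1 * t 2 + qPhi 0 0 0 t := funext quadricF_eq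
  rw [e]
  refine ContDiffOn.add (ContDiff.contDiffOn (by fun_prop)) ?_
  exact contDiffOn_ev (dominated_qjet 0 0 0) (by omega)

/-- The series converges for small `t₄`. -/
theorem summable_quadricTerm_of_small {t : Fin 4 → 𝕜}
    (h : 1024 * Real.exp (‖t 1‖ + ‖t 2‖) * ‖t 3‖ < 1) : Summable (quadricTerm t) := by
  set ρ := 1024 * Real.exp (‖t 1‖ + ‖t 2‖) * ‖t 3‖ with hρ
  have hρ0 : 0 ≤ ρ := by positivity
  have hg := summable_geometric_of_lt_one hρ0 h
  have hs : Summable fun p : ℕ × ℕ => ρ ^ p.1 * ρ ^ p.2 :=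
    hg.mul_of_nonneg hg (fun _ => by positivity) (fun _ => by positivity)
  refine Summable.of_norm_bounded hs fun p => ?_
  have hc : ∀ c : ℚ, ‖(c : 𝕜)‖ = |(c : ℝ)| := fun c => by
    rw [← RCLike.ofReal_ratCast, RCLike.norm_ofReal]
  rw [quadricTerm_eq, evTerm, norm_mul, norm_mul, norm_pow, hc, co_jet, ← pow_add]
  rcases Nat.eq_zero_or_pos (p.1 + p.2) with h0 | h0
  · obtain ⟨h1, h2⟩ : p.1 = 0 ∧ p.2 = 0 := by omega
    rw [h1, h2, potCoeff_zero quadricN_zero]; simp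
  have hz : ‖t 3‖ ≤ 1 := by
    have : 1 ≤ 1024 * Real.exp (‖t 1‖ + ‖t 2‖) := by
      have := Real.one_le_exp (x := ‖t 1‖ + ‖t 2‖) (by positivity)
      linarith
    nlinarith [norm_nonneg (t 3)]
  have hM := abs_potCoeff_le p.1 p.2
  have hE : ‖NormedSpace.exp ((p.1 : 𝕜) * t 1 + (p.2 : 𝕜) * t 2)‖ ≤
      Real.exp (‖t 1‖ + ‖t 2‖) ^ (p.1 + p.2) := by
    refine (norm_exp_le _).trans ?_
    rw [← Real.exp_nat_mul, Real.exp_le_exp]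
    refine (norm_add_le _ _).trans ?_
    rw [norm_mul, norm_mul, RCLike.norm_natCast, RCLike.norm_natCast]
    push_cast
    nlinarith [mul_nonneg (p.1.cast_nonneg (α := ℝ)) (norm_nonneg (t 2)),
      mul_nonneg (p.2.cast_nonneg (α := ℝ)) (norm_nonneg (t 1))]
  have hZ : ‖t 3‖ ^ (2 * (p.1 + p.2) - 1) ≤ ‖t 3‖ ^ (p.1 + p.2) :=
    pow_le_pow_of_le_one (norm_nonneg _) hz (by omega)
  simp only [pow_zero, fallingProd_zero, one_mul]
  calc _ ≤ 1024 ^ (p.1 + p.2) * ‖t 3‖ ^ (p.1 + p.2) *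
        Real.exp (‖t 1‖ + ‖t 2‖) ^ (p.1 + p.2) := by gcongr
    _ = ρ ^ (p.1 + p.2) := by rw [hρ, mul_pow, mul_pow]; ring

theorem mem_quadricRegion_of_zero {t : Fin 4 → 𝕜} (h : t 3 = 0) : t ∈ quadricRegion 𝕜 := by
  have ho : IsOpen {t : Fin 4 → 𝕜 | 1024 * Real.exp (‖t 1‖ + ‖t 2‖) * ‖t 3‖ < 1} :=
    isOpen_lt (by fun_prop) continuous_const
  have hsub : {t : Fin 4 → 𝕜 | 1024 * Real.exp (‖t 1‖ + ‖t 2‖) * ‖t 3‖ < 1} ⊆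
      {t | Summable (quadricTerm t)} := fun t ht => summable_quadricTerm_of_small ht
  exact interior_maximal hsub ho (by simp [h])

theorem summable_quadricTerm_mono {t t' : Fin 4 → 𝕜} (h1 : t' 1 = t 1) (h2 : t' 2 = t 2)
    (h3 : ‖t' 3‖ ≤ ‖t 3‖) (h : Summable (quadricTerm t)) : Summable (quadricTerm t') := by
  refine Summable.of_norm_bounded h.norm fun p => ?_
  simp only [quadricTerm_eq, evTerm, norm_mul, norm_pow, h1, h2]
  gcongr

/-- Shrinking the last coordinate. -/
theorem scale_mem_quadricRegion {t : Fin 4 → 𝕜} (ht : t ∈ quadricRegion 𝕜) {s : ℝ} (hs0 : 0 ≤ s)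
    (hs1 : s ≤ 1) : ![t 0, t 1, t 2, (s : 𝕜) * t 3] ∈ quadricRegion 𝕜 := by
  rcases hs0.eq_or_lt with rfl | hs
  · exact mem_quadricRegion_of_zero (by simp)
  have hs' : (s : 𝕜) ≠ 0 := by exact_mod_cast hs.ne'
  let g : (Fin 4 → 𝕜) → (Fin 4 → 𝕜) := fun u => ![u 0, u 1, u 2, (s : 𝕜)⁻¹ * u 3]
  have hg : Continuous g := by
    refine continuous_pi fun i => ?_
    fin_cases i <;> simp [g] <;> fun_prop
  have hgt : g ![t 0, t 1, t 2, (s : 𝕜) * t 3] = t := by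
    funext i
    fin_cases i <;> simp [g, hs']
  have ho := isOpen_quadricRegion.preimage hg
  have hsub : g ⁻¹' quadricRegion 𝕜 ⊆ {t | Summable (quadricTerm t)} := by
    intro u hu
    refine summable_quadricTerm_mono (t := g u) rfl rfl ?_ (summable_of_mem hu)
    change ‖u 3‖ ≤ ‖(s : 𝕜)⁻¹ * u 3‖
    rw [norm_mul, norm_inv, RCLike.norm_ofReal, abs_of_pos hs]
    exact le_mul_of_one_le_left (norm_nonneg _) ((one_le_inv₀ hs).mpr hs1)
  refine interior_maximal hsub ho ?_
  rw [Set.mem_preimage, hgt]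
  exact ht

/-- A set is connected if it contains a line segment from each point to a connected core. -/
theorem isConnected_of_segments {E : Type*} [NormedAddCommGroup E] [NormedSpace ℝ E] {S : Set E}
    (π : E →ₗ[ℝ] E) (h0 : ∀ x, π x ∈ S) (h : ∀ x ∈ S, segment ℝ x (π x) ⊆ S) :
    IsConnected S := by
  refine ⟨⟨π 0, h0 0⟩, isPreconnected_of_forall (π 0) fun x hx => ?_⟩
  have hsub : segment ℝ (π x) (π 0) ⊆ S := by
    rintro _ ⟨a, b, _, _, _, rfl⟩
    rw [← map_smul, ← map_smul, ← map_add]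
    exact h0 _
  exact ⟨segment ℝ x (π x) ∪ segment ℝ (π x) (π 0), Set.union_subset (h x hx) hsub,
    Or.inr (right_mem_segment ℝ _ _), Or.inl (left_mem_segment ℝ _ _),
    (convex_segment x (π x)).isPreconnected.union (π x) (right_mem_segment ℝ _ _)
      (left_mem_segment ℝ _ _) (convex_segment (π x) (π 0)).isPreconnected⟩

/-- Setting one coordinate to zero. -/
noncomputable def killCoord (𝕜 : Type*) [RCLike 𝕜] {m : ℕ} (j : Fin m) : (Fin m → 𝕜) →ₗ[ℝ] (Fin m → 𝕜) :=
  LinearMap.pi fun i => if i = j then 0 else LinearMap.proj i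

theorem isConnected_quadricRegion : IsConnected (quadricRegion 𝕜) := by
  refine isConnected_of_segments (killCoord 𝕜 3)
    (fun x => mem_quadricRegion_of_zero (by simp [killCoord])) ?_
  rintro x hx _ ⟨a, b, ha, hb, hab, rfl⟩
  convert scale_mem_quadricRegion hx ha (by linarith : a ≤ 1) using 1
  funext i
  have hab' : (a : 𝕜) + b = 1 := by exact_mod_cast hab
  fin_cases i <;> simp [killCoord, RCLike.real_smul_eq_coe_mul, ← add_mul, hab']

/-- Quasihomogeneity of the prepotential. -/
theorem euler_quadricF {t : Fin 4 → 𝕜} (ht : t ∈ quadricRegion 𝕜) :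
    ∑ i, quadricE t i * pd i quadricF t = 1 / 2 * quadricF t + t 0 * (t 1 + t 2) := by
  have hh : qPhi 1 0 0 t + qPhi 0 1 0 t - 1 / 2 * (t 3 * qPhi 0 0 1 t) = 1 / 2 * qPhi 0 0 0 t := by
    have h1 := ((hasSum_qPhi ht 1 0 0).add (hasSum_qPhi ht 0 1 0)).sub
      (((hasSum_qPhi ht 0 0 1).mul_left (t 3)).mul_left (1 / 2))
    refine h1.unique ?_
    have h2 := (hasSum_qPhi ht 0 0 0).mul_left (1 / 2)
    refine (congrArg (fun F => HasSum F _) (funext fun p => ?_)).mpr h2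
    simp only [evTerm, co_jet, fallingProd_zero, fallingProd_succ]
    rcases Nat.eq_zero_or_pos (p.1 + p.2) with h0 | h0
    · obtain ⟨h1, h2⟩ : p.1 = 0 ∧ p.2 = 0 := by omega
      rw [h1, h2, potCoeff_zero quadricN_zero]; simp
    · rw [show 2 * (p.1 + p.2) - (0 + 1) = (2 * (p.1 + p.2) - (1 + 1)) + 1 by omega, pow_succ]
      push_cast
      ring
  simp only [pd_quadricF ht, Fin.sum_univ_four, quadricF_eq]
  simp [quadricE, quadricGrad]
  linear_combination hh

theorem isFrobeniusManifold_quadric :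
    IsFrobeniusManifold (quadricRegion 𝕜) (quadricF : (Fin 4 → 𝕜) → 𝕜) quadricE where
  isOpen := isOpen_quadricRegion
  isConnected := isConnected_quadricRegion
  smooth := contDiffOn_quadricF
  normalization := ⟨antidiagonal 4, isUnit_det_antidiagonal 4, fun _ => metric_quadricF⟩
  circ_comm _ ht := circ_quadricF_comm ht
  circ_assoc _ ht := circ_quadricF_assoc ht
  one_circ _ ht := one_circ_quadricF ht
  euler_affine := ⟨Matrix.diagonal ![1 / 2, 0, 0, -(1 / 2)], ![0, 1, 1, 0], fun t _ => by
    funext i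
    fin_cases i <;> simp [quadricE, Matrix.mulVec_diagonal]⟩
  homogeneous := ⟨1 / 2, Matrix.of ![![0, 1, 1, 0], 0, 0, 0], 0, 0, fun t ht => by
    rw [euler_quadricF ht]
    simp [Fin.sum_univ_four]
    ring⟩

end

end FrobeniusMfd
namespace FrobeniusMfd

section
variable {𝕜 : Type*} [RCLike 𝕜]

/-! ### The hyperplane -/

/-- The parametrization of the hyperplane as a linear map. -/
noncomputable def hyperplaneCLM (𝕜 : Type*) [RCLike 𝕜] : (Fin 3 → 𝕜) →L[𝕜] (Fin 4 → 𝕜) :=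
  ContinuousLinearMap.pi ![ContinuousLinearMap.proj 0,
    (1 / ((Real.sqrt 2 : ℝ) : 𝕜)) • ContinuousLinearMap.proj 1,
    (1 / ((Real.sqrt 2 : ℝ) : 𝕜)) • ContinuousLinearMap.proj 1, ContinuousLinearMap.proj 2]

theorem hyperplaneParam_eq : (hyperplaneParam : (Fin 3 → 𝕜) → (Fin 4 → 𝕜)) = hyperplaneCLM 𝕜 := by
  funext τ i
  fin_cases i <;> simp [hyperplaneParam, hyperplaneCLM]

theorem fderiv_hyperplaneParam (τ v : Fin 3 → 𝕜) :
    fderiv 𝕜 hyperplaneParam τ v = hyperplaneParam v := by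
  rw [hyperplaneParam_eq, ContinuousLinearMap.fderiv]

theorem continuous_hyperplaneParam :
    Continuous (hyperplaneParam : (Fin 3 → 𝕜) → (Fin 4 → 𝕜)) := by
  rw [hyperplaneParam_eq]; exact (hyperplaneCLM 𝕜).continuous

theorem sqrt_two_ne_zero' : ((Real.sqrt 2 : ℝ) : 𝕜) ≠ 0 := by
  exact_mod_cast (Real.sqrt_pos.mpr zero_lt_two).ne'

theorem inv_sqrt_two_sq : (1 / ((Real.sqrt 2 : ℝ) : 𝕜)) * (1 / ((Real.sqrt 2 : ℝ) : 𝕜)) = 1 / 2 := by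
  rw [div_mul_div_comm, one_mul, ← RCLike.ofReal_mul, Real.mul_self_sqrt zero_le_two, RCLike.ofReal_ofNat]

/-- The inverse of the parametrization on the hyperplane. -/
noncomputable def hyperplaneInv (t : Fin 4 → 𝕜) : Fin 3 → 𝕜 :=
  ![t 0, ((Real.sqrt 2 : ℝ) : 𝕜) * t 1, t 3]

theorem hyperplaneInv_leftInverse :
    Function.LeftInverse hyperplaneInv (hyperplaneParam : (Fin 3 → 𝕜) → (Fin 4 → 𝕜)) := by
  intro τ
  have := sqrt_two_ne_zero' (𝕜 := 𝕜)
  funext i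
  fin_cases i <;> simp [hyperplaneInv, hyperplaneParam, this]

theorem isParametrization_hyperplane :
    IsParametrization (quadricRegion 𝕜) {t | t ∈ quadricRegion 𝕜 ∧ t 1 = t 2}
      (hyperplaneParam ⁻¹' quadricRegion 𝕜) hyperplaneParam where
  isOpen := isOpen_quadricRegion.preimage continuous_hyperplaneParam
  smooth := by rw [hyperplaneParam_eq]; exact (hyperplaneCLM 𝕜).contDiff.contDiffOn
  immersion τ _ a b h := by
    rw [fderiv_hyperplaneParam, fderiv_hyperplaneParam] at h
    exact hyperplaneInv_leftInverse.injective h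
  embedding := by
    rw [Set.domRestrict_eq]
    refine (hyperplaneInv_leftInverse.isEmbedding ?_ continuous_hyperplaneParam).comp
      Topology.IsEmbedding.subtypeVal
    refine continuous_pi fun i => ?_
    fin_cases i <;> simp [hyperplaneInv] <;> fun_prop
  image_eq := by
    ext t
    constructor
    · rintro ⟨τ, hτ, rfl⟩
      exact ⟨hτ, rfl⟩
    · rintro ⟨ht, h12⟩
      have e : hyperplaneParam (hyperplaneInv t) = t := by
        have := sqrt_two_ne_zero' (𝕜 := 𝕜)
        funext i
        fin_cases i <;> simp [hyperplaneInv, hyperplaneParam, this, h12]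
      exact ⟨hyperplaneInv t, by rw [Set.mem_preimage, e]; exact ht, e⟩
  subset := fun _ h => h.1

theorem qPhi_symm {t : Fin 4 → 𝕜} (h : t 1 = t 2) (i j k : ℕ) :
    qPhi i j k t = qPhi j i k t := by
  rw [qPhi, qPhi, ev, ev, ← (Equiv.prodComm ℕ ℕ).tsum_eq]
  refine tsum_congr fun p => ?_
  simp only [evTerm, Equiv.prodComm_apply, Prod.fst_swap, Prod.snd_swap, h]
  rw [co_qjet_symm, add_comm p.2 p.1, add_comm ((p.2 : 𝕜) * t 2)]

theorem pd_congr_of_eqOn {m : ℕ} {f g : (Fin m → 𝕜) → 𝕜} {U : Set (Fin m → 𝕜)} (hU : IsOpen U)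
    {t : Fin m → 𝕜} (ht : t ∈ U) (h : ∀ x ∈ U, f x = g x) (i : Fin m) : pd i f t = pd i g t := by
  rw [pd, pd, Filter.EventuallyEq.fderiv_eq (Filter.eventually_of_mem (hU.mem_nhds ht) h)]

theorem HasPd.pd_comp {f : (Fin 4 → 𝕜) → 𝕜} {τ : Fin 3 → 𝕜} {v : Fin 4 → 𝕜}
    (h : HasPd f (hyperplaneParam τ) v) (α : Fin 3) :
    pd α (fun τ => f (hyperplaneParam τ)) τ =
      ∑ i, v i * hyperplaneParam (Pi.single α 1) i := by
  have h1 : HasFDerivAt f (∑ i, v i • coord 𝕜 i) (hyperplaneCLM 𝕜 τ) := by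
    rw [← hyperplaneParam_eq]; exact h
  have := h1.comp τ (hyperplaneCLM 𝕜).hasFDerivAt
  rw [pd, hyperplaneParam_eq, show (fun τ => f ((hyperplaneCLM 𝕜) τ)) = f ∘ hyperplaneCLM 𝕜 from rfl,
    this.fderiv]
  simp

theorem HasPd.linComb {f : Fin 4 → (Fin 4 → 𝕜) → 𝕜} {t : Fin 4 → 𝕜} {v : Fin 4 → Fin 4 → 𝕜}
    (h : ∀ k, HasPd (f k) t (v k)) (c : Fin 4 → 𝕜) :
    HasPd (fun t => ∑ k, f k t * c k) t (fun j => ∑ k, v k j * c k) := by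
  simp only [Fin.sum_univ_four]
  have e := fun k => (h k).mul (hasPd_const (c k) t)
  refine ((((e 0).add (e 1)).add (e 2)).add (e 3)).congr ?_
  funext j
  simp [mul_comm]

/-- The restriction of the prepotential to the hyperplane. -/
noncomputable def restrictedF (τ : Fin 3 → 𝕜) : 𝕜 := quadricF (hyperplaneParam τ)

/-- The region of parameters. -/
abbrev hyperplaneRegion (𝕜 : Type*) [RCLike 𝕜] : Set (Fin 3 → 𝕜) :=
  hyperplaneParam ⁻¹' quadricRegion 𝕜

theorem pd_restrictedF {τ : Fin 3 → 𝕜} (hτ : τ ∈ hyperplaneRegion 𝕜) (γ : Fin 3) :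
    pd γ restrictedF τ =
      ∑ k, pd k quadricF (hyperplaneParam τ) * hyperplaneParam (Pi.single γ 1) k := by
  have := (hasPd_quadricF hτ).pd_comp γ
  simp only [pd_quadricF hτ]
  exact this

theorem pd_pd_restrictedF {τ : Fin 3 → 𝕜} (hτ : τ ∈ hyperplaneRegion 𝕜) (β γ : Fin 3) :
    pd β (pd γ restrictedF) τ =
      ∑ j, (∑ k, pd j (pd k quadricF) (hyperplaneParam τ) * hyperplaneParam (Pi.single γ 1) k) *
        hyperplaneParam (Pi.single β 1) j := by
  rw [pd_congr_of_eqOn isParametrization_hyperplane.isOpen hτ (fun x hx => pd_restrictedF hx γ)]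
  have := (HasPd.linComb (fun k => hasPd_pd_quadricF hτ k)
    (hyperplaneParam (Pi.single γ 1))).pd_comp β
  rw [this]
  simp only [fun j k => (hasPd_pd_quadricF hτ k).pd_eq j]

theorem c3_restrictedF {τ : Fin 3 → 𝕜} (hτ : τ ∈ hyperplaneRegion 𝕜) (α β γ : Fin 3) :
    c3 restrictedF α β γ τ = ∑ i, (∑ j, (∑ k, quadricThird (hyperplaneParam τ) i j k *
      hyperplaneParam (Pi.single γ 1) k) * hyperplaneParam (Pi.single β 1) j) *
        hyperplaneParam (Pi.single α 1) i := by
  rw [c3, pd_congr_of_eqOn isParametrization_hyperplane.isOpen hτ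
    (fun x hx => pd_pd_restrictedF hx β γ)]
  exact (HasPd.linComb (fun j => HasPd.linComb (fun k => hasPd_pd_pd_quadricF hτ j k)
    (hyperplaneParam (Pi.single γ 1))) (hyperplaneParam (Pi.single β 1))).pd_comp α

theorem hyperplaneParam_single_zero :
    hyperplaneParam (Pi.single 0 1 : Fin 3 → 𝕜) = ![1, 0, 0, 0] := by
  simp [hyperplaneParam]

theorem hyperplaneParam_single_one : hyperplaneParam (Pi.single 1 1 : Fin 3 → 𝕜) =
    ![0, 1 / ((Real.sqrt 2 : ℝ) : 𝕜), 1 / ((Real.sqrt 2 : ℝ) : 𝕜), 0] := by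
  simp [hyperplaneParam]

theorem hyperplaneParam_single_two :
    hyperplaneParam (Pi.single 2 1 : Fin 3 → 𝕜) = ![0, 0, 0, 1] := by
  simp [hyperplaneParam]

/-- Third derivatives of the restricted prepotential. -/
noncomputable def restrictedThird (τ : Fin 3 → 𝕜) : Fin 3 → Fin 3 → Fin 3 → 𝕜 :=
  let t := hyperplaneParam τ
  let c := 1 / ((Real.sqrt 2 : ℝ) : 𝕜)
  ![![![0, 0, 1], ![0, 1, 0], ![1, 0, 0]],
    ![![0, 1, 0], ![1, c * (qPhi 3 0 0 t + 3 * qPhi 2 1 0 t), qPhi 2 0 1 t + qPhi 1 1 1 t],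
      ![0, qPhi 2 0 1 t + qPhi 1 1 1 t, 2 * c * qPhi 1 0 2 t]],
    ![![1, 0, 0], ![0, qPhi 2 0 1 t + qPhi 1 1 1 t, 2 * c * qPhi 1 0 2 t],
      ![0, 2 * c * qPhi 1 0 2 t, qPhi 0 0 3 t]]]

theorem c3_restrictedF_eq {τ : Fin 3 → 𝕜} (hτ : τ ∈ hyperplaneRegion 𝕜) (α β γ : Fin 3) :
    c3 restrictedF α β γ τ = restrictedThird τ α β γ := by
  have hs : ∀ i j k, qPhi i j k (hyperplaneParam τ) = qPhi j i k (hyperplaneParam τ) :=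
    qPhi_symm rfl
  have hc := inv_sqrt_two_sq (𝕜 := 𝕜)
  rw [c3_restrictedF hτ, restrictedThird]
  simp only [Fin.sum_univ_four]
  fin_cases α <;> fin_cases β <;> fin_cases γ <;>
  simp only [Fin.zero_eta, Fin.mk_one, Fin.reduceFinMk, hyperplaneParam_single_zero,
    hyperplaneParam_single_one, hyperplaneParam_single_two] <;>
  generalize 1 / ((Real.sqrt 2 : ℝ) : 𝕜) = c at hc ⊢ <;>
  simp [quadricThird, hs 0 3 0, hs 1 2 0, hs 0 2 1, hs 0 1 2] <;>
  first
  | linear_combination 2 * hc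
  | ring1
  | linear_combination 2 * (qPhi 2 0 1 (hyperplaneParam τ) + qPhi 1 1 1 (hyperplaneParam τ)) * hc
  | linear_combination
      c * (2 * qPhi 3 0 0 (hyperplaneParam τ) + 6 * qPhi 2 1 0 (hyperplaneParam τ)) * hc

theorem metric_restrictedF {τ : Fin 3 → 𝕜} (hτ : τ ∈ hyperplaneRegion 𝕜) :
    metric restrictedF τ = antidiagonal 3 := by
  ext i j
  rw [metric, Matrix.of_apply, c3_restrictedF_eq hτ, antidiagonal, Matrix.of_apply]
  fin_cases i <;> fin_cases j <;> simp [restrictedThird]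

theorem pairing_quadricF {t : Fin 4 → 𝕜} (ht : t ∈ quadricRegion 𝕜) (a b : Fin 4 → 𝕜) :
    pairing quadricF t a b = a 0 * b 3 + a 1 * b 2 + a 2 * b 1 + a 3 * b 0 := by
  simp [pairing, metric_quadricF ht, antidiagonal, Fin.sum_univ_four]

theorem inducedMetric_hyperplane {τ : Fin 3 → 𝕜} (hτ : τ ∈ hyperplaneRegion 𝕜) :
    inducedMetric quadricF hyperplaneParam τ = antidiagonal 3 := by
  ext i j
  rw [inducedMetric, Matrix.of_apply, pairing_quadricF hτ, antidiagonal, Matrix.of_apply]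
  simp only [tangentBasis, fderiv_hyperplaneParam]
  have hc := inv_sqrt_two_sq (𝕜 := 𝕜)
  fin_cases i <;> fin_cases j <;>
  simp only [Fin.zero_eta, Fin.mk_one, Fin.reduceFinMk, hyperplaneParam_single_zero,
    hyperplaneParam_single_one, hyperplaneParam_single_two] <;>
  generalize 1 / ((Real.sqrt 2 : ℝ) : 𝕜) = c at hc ⊢ <;>
  simp
  linear_combination 2 * hc

/-- The orthogonal projection is a left inverse of the inclusion of the tangent space. -/
theorem proj_hyperplaneParam {τ : Fin 3 → 𝕜} (hτ : τ ∈ hyperplaneRegion 𝕜) (v : Fin 3 → 𝕜) :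
    proj quadricF hyperplaneParam τ (hyperplaneParam v) = v := by
  funext γ
  rw [proj, inducedMetric_hyperplane hτ, antidiagonal_inv, sum_antidiagonal_mul,
    pairing_quadricF hτ, tangentBasis, fderiv_hyperplaneParam]
  have hc := inv_sqrt_two_sq (𝕜 := 𝕜)
  fin_cases γ <;>
  simp only [Fin.zero_eta, Fin.mk_one, Fin.reduceFinMk, Fin.rev, Fin.reduceSub,
    hyperplaneParam_single_zero, hyperplaneParam_single_one, hyperplaneParam_single_two,
    hyperplaneParam] <;>
  generalize 1 / ((Real.sqrt 2 : ℝ) : 𝕜) = c at hc ⊢ <;>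
  simp [hyperplaneParam_single_zero, hyperplaneParam_single_one, hyperplaneParam_single_two]
  linear_combination 2 * v 1 * hc

theorem circ_restrictedF {τ : Fin 3 → 𝕜} (hτ : τ ∈ hyperplaneRegion 𝕜) (a b : Fin 3 → 𝕜) :
    circ restrictedF τ a b =
      fun k => ∑ i, ∑ j, restrictedThird τ i j (Fin.rev k) * a i * b j := by
  funext k
  simp only [circ, structFun, metric_restrictedF hτ, antidiagonal_inv, sum_antidiagonal_mul,
    c3_restrictedF_eq hτ]

/-- The product of tangent vectors is tangent, and is the product of the restricted potential. -/
theorem hyperplaneParam_circ {τ : Fin 3 → 𝕜} (hτ : τ ∈ hyperplaneRegion 𝕜) (a b : Fin 3 → 𝕜) :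
    hyperplaneParam (circ restrictedF τ a b) =
      circ quadricF (hyperplaneParam τ) (hyperplaneParam a) (hyperplaneParam b) := by
  have hs : ∀ i j k, qPhi i j k (hyperplaneParam τ) = qPhi j i k (hyperplaneParam τ) :=
    qPhi_symm rfl
  have hc := inv_sqrt_two_sq (𝕜 := 𝕜)
  rw [circ_quadricF_eq hτ, circ_restrictedF hτ, hs 0 3 0, hs 1 2 0, hs 0 2 1, hs 0 1 2]
  simp only [restrictedThird]
  generalize hyperplaneParam τ = t
  simp only [hyperplaneParam]
  generalize 1 / ((Real.sqrt 2 : ℝ) : 𝕜) = c at hc ⊢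
  generalize qPhi 3 0 0 t = x30
  generalize qPhi 2 1 0 t = x21
  generalize qPhi 2 0 1 t = y20
  generalize qPhi 1 1 1 t = y11
  generalize qPhi 1 0 2 t = z
  generalize qPhi 0 0 3 t = w
  funext k
  fin_cases k <;> simp [Fin.sum_univ_three, Fin.rev]
  · linear_combination -2 * (y20 + y11) * a 1 * b 1 * hc
  · linear_combination 2 * z * a 2 * b 2 * hc
  · linear_combination 2 * z * a 2 * b 2 * hc
  · linear_combination -2 * a 1 * b 1 * hc

end

end FrobeniusMfd
namespace FrobeniusMfd

section
variable {𝕜 : Type*} [RCLike 𝕜]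

/-! ### The natural Frobenius submanifold -/

/-- The Euler vector field of the hyperplane. -/
noncomputable def restrictedE (τ : Fin 3 → 𝕜) : Fin 3 → 𝕜 :=
  ![1 / 2 * τ 0, ((Real.sqrt 2 : ℝ) : 𝕜), -(1 / 2) * τ 2]

theorem hyperplaneParam_restrictedE (τ : Fin 3 → 𝕜) :
    hyperplaneParam (restrictedE τ) = quadricE (hyperplaneParam τ) := by
  have := sqrt_two_ne_zero' (𝕜 := 𝕜)
  funext i
  fin_cases i <;> simp [hyperplaneParam, restrictedE, quadricE, this]

theorem proj_quadricE {τ : Fin 3 → 𝕜} (hτ : τ ∈ hyperplaneRegion 𝕜) :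
    proj quadricF hyperplaneParam τ (quadricE (hyperplaneParam τ)) = restrictedE τ := by
  rw [← hyperplaneParam_restrictedE, proj_hyperplaneParam hτ]

theorem circ_restrictedF_eq_inducedMul {τ : Fin 3 → 𝕜} (hτ : τ ∈ hyperplaneRegion 𝕜)
    (a b : Fin 3 → 𝕜) :
    circ restrictedF τ a b = inducedMul quadricF hyperplaneParam τ a b := by
  rw [inducedMul, fderiv_hyperplaneParam, fderiv_hyperplaneParam, ← hyperplaneParam_circ hτ,
    proj_hyperplaneParam hτ]

theorem isConnected_hyperplaneRegion : IsConnected (hyperplaneRegion 𝕜) := by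
  refine isConnected_of_segments (killCoord 𝕜 2)
    (fun x => mem_quadricRegion_of_zero (by simp [killCoord, hyperplaneParam])) ?_
  rintro x hx _ ⟨a, b, ha, hb, hab, rfl⟩
  rw [Set.mem_preimage]
  convert scale_mem_quadricRegion hx ha (by linarith : a ≤ 1) using 1
  funext i
  have hab' : (a : 𝕜) + b = 1 := by exact_mod_cast hab
  fin_cases i <;>
    simp [killCoord, hyperplaneParam, RCLike.real_smul_eq_coe_mul, ← add_mul, hab']

theorem euler_restrictedF {τ : Fin 3 → 𝕜} (hτ : τ ∈ hyperplaneRegion 𝕜) :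
    ∑ α, restrictedE τ α * pd α restrictedF τ =
      1 / 2 * restrictedF τ + 2 * (1 / ((Real.sqrt 2 : ℝ) : 𝕜)) * (τ 0 * τ 1) := by
  have h := euler_quadricF hτ
  have e : ∑ α, restrictedE τ α * pd α restrictedF τ =
      ∑ i, quadricE (hyperplaneParam τ) i * pd i quadricF (hyperplaneParam τ) := by
    simp only [pd_restrictedF hτ, ← hyperplaneParam_restrictedE]
    simp [Fin.sum_univ_three, Fin.sum_univ_four, hyperplaneParam_single_zero,
      hyperplaneParam_single_one, hyperplaneParam_single_two]
    simp [hyperplaneParam]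
    ring
  rw [e, h, restrictedF]
  simp [hyperplaneParam]
  ring

theorem isFrobeniusManifold_restrictedF : IsFrobeniusManifold (hyperplaneRegion 𝕜)
    (restrictedF : (Fin 3 → 𝕜) → 𝕜)
    (fun τ => proj quadricF hyperplaneParam τ (quadricE (hyperplaneParam τ))) where
  isOpen := isParametrization_hyperplane.isOpen
  isConnected := isConnected_hyperplaneRegion
  smooth := contDiffOn_quadricF.comp isParametrization_hyperplane.smooth (fun _ h => h)
  normalization := ⟨antidiagonal 3, isUnit_det_antidiagonal 3, fun _ => metric_restrictedF⟩
  circ_comm τ hτ a b := hyperplaneInv_leftInverse.injective <| by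
    rw [hyperplaneParam_circ hτ, hyperplaneParam_circ hτ, circ_quadricF_comm hτ]
  circ_assoc τ hτ a b c := hyperplaneInv_leftInverse.injective <| by
    simp only [hyperplaneParam_circ hτ, circ_quadricF_assoc hτ]
  one_circ τ hτ a := hyperplaneInv_leftInverse.injective <| by
    have e : (![1, 0, 0, 0] : Fin 4 → 𝕜) = Pi.single 0 1 := by
      funext i; fin_cases i <;> simp
    rw [hyperplaneParam_circ hτ, hyperplaneParam_single_zero, e, one_circ_quadricF hτ]
  euler_affine := ⟨Matrix.diagonal ![1 / 2, 0, -(1 / 2)], ![0, ((Real.sqrt 2 : ℝ) : 𝕜), 0],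
    fun τ hτ => by
      rw [proj_quadricE hτ]
      funext i
      fin_cases i <;> simp [restrictedE, Matrix.mulVec_diagonal]⟩
  homogeneous := ⟨1 / 2, Matrix.of ![![0, 2 * (1 / ((Real.sqrt 2 : ℝ) : 𝕜)), 0], 0, 0], 0, 0,
    fun τ hτ => by
      rw [proj_quadricE hτ, euler_restrictedF hτ]
      simp [Fin.sum_univ_three]
      ring⟩

theorem isNaturalFrobeniusSubmanifold_hyperplane :
    IsNaturalFrobeniusSubmanifold (quadricRegion 𝕜) quadricF quadricE
      {t | t ∈ quadricRegion 𝕜 ∧ t 1 = t 2} (hyperplaneRegion 𝕜) hyperplaneParam restrictedF where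
  ambient := isFrobeniusManifold_quadric
  param := isParametrization_hyperplane
  frobenius := isFrobeniusManifold_restrictedF
  metric_eq τ hτ := by rw [metric_restrictedF hτ, inducedMetric_hyperplane hτ]
  circ_eq τ hτ a b := circ_restrictedF_eq_inducedMul hτ a b
  natural τ hτ a b := by
    rw [← circ_restrictedF_eq_inducedMul hτ, fderiv_hyperplaneParam, fderiv_hyperplaneParam,
      fderiv_hyperplaneParam, hyperplaneParam_circ hτ]

/-- The restricted prepotential in terms of the contracted invariants. -/
theorem hasSum_restrictedF {τ : Fin 3 → 𝕜} (hτ : τ ∈ hyperplaneRegion 𝕜) :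
    HasSum (fun n : ℕ => (contractedN (n + 1) : 𝕜) / ((2 * (n + 1) - 1).factorial : 𝕜) *
        τ 2 ^ (2 * (n + 1) - 1) *
        NormedSpace.exp (((n + 1 : ℕ) : 𝕜) * τ 1 / ((Real.sqrt 2 : ℝ) : 𝕜)))
      (quadricF (hyperplaneParam τ) - (1 / 2 * τ 0 ^ 2 * τ 2 + 1 / 2 * τ 0 * τ 1 ^ 2)) := by
  have hc := inv_sqrt_two_sq (𝕜 := 𝕜)
  have e : quadricF (hyperplaneParam τ) - (1 / 2 * τ 0 ^ 2 * τ 2 + 1 / 2 * τ 0 * τ 1 ^ 2) =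
      qPhi 0 0 0 (hyperplaneParam τ) := by
    rw [quadricF_eq]
    generalize qPhi 0 0 0 (hyperplaneParam τ) = x
    simp only [hyperplaneParam]
    generalize 1 / ((Real.sqrt 2 : ℝ) : 𝕜) = c at hc ⊢
    simp
    linear_combination τ 0 * τ 1 ^ 2 * hc
  have h := (hasSum_qPhi hτ 0 0 0).tsum_fiberwise (fun p : ℕ × ℕ => p.1 + p.2)
  set g : ℕ → 𝕜 := fun n => (contractedCoeff n : 𝕜) * τ 2 ^ (2 * n - 1) *
    NormedSpace.exp ((n : 𝕜) * τ 1 / ((Real.sqrt 2 : ℝ) : 𝕜)) with hg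
  have hgs : HasSum g (qPhi 0 0 0 (hyperplaneParam τ)) := by
    refine (congrArg (fun F => HasSum F _) (funext fun n => ?_)).mpr h
    have hset : (fun p : ℕ × ℕ => p.1 + p.2) ⁻¹' {n} =
        (Finset.HasAntidiagonal.antidiagonal n : Set (ℕ × ℕ)) := by
      ext p; simp
    rw [hset, Finset.tsum_subtype' (Finset.HasAntidiagonal.antidiagonal n), hg]
    simp only [contractedCoeff_eq, Rat.cast_sum, Finset.sum_mul]
    refine Finset.sum_congr rfl fun p hp => ?_
    have hp := Finset.HasAntidiagonal.mem_antidiagonal.mp hp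
    have e1 : hyperplaneParam τ 1 = 1 / ((Real.sqrt 2 : ℝ) : 𝕜) * τ 1 := rfl
    have e2 : hyperplaneParam τ 2 = 1 / ((Real.sqrt 2 : ℝ) : 𝕜) * τ 1 := rfl
    have e3 : hyperplaneParam τ 3 = τ 2 := rfl
    rw [evTerm, co_jet, e1, e2, e3, hp, ← hp]
    simp only [pow_zero, fallingProd_zero, one_mul]
    congr 2
    push_cast
    ring
  have h0 : g 0 = 0 := by
    rw [hg]; simp [contractedCoeff_eq, potCoeff_zero quadricN_zero]
  rw [e]
  have h1 := (hasSum_nat_add_iff' 1).mpr hgs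
  rw [Finset.sum_range_one, h0, sub_zero] at h1
  refine (congrArg (fun F => HasSum F _) (funext fun n => ?_)).mpr h1
  simp only [hg, contractedCoeff]
  push_cast
  rfl

end

end FrobeniusMfd
theorem mainTheorem7 :
    -- the numbers `N_{ab}` are the unique solution of the system which determines them
    (FrobeniusMfd.IsQuadricCount FrobeniusMfd.quadricN ∧
      ∀ N : ℕ → ℕ → ℤ, FrobeniusMfd.IsQuadricCount N → N = FrobeniusMfd.quadricN) ∧
    -- the hyperplane `t₂ = t₃`, over `ℝ` and over `ℂ`
    (∀ (𝕜 : Type) [RCLike 𝕜],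
      -- it is a natural Frobenius submanifold with `F_N = F|_N`
      FrobeniusMfd.IsNaturalFrobeniusSubmanifold
        (FrobeniusMfd.quadricRegion 𝕜) FrobeniusMfd.quadricF FrobeniusMfd.quadricE
        {t | t ∈ FrobeniusMfd.quadricRegion 𝕜 ∧ t 1 = t 2}
        (FrobeniusMfd.hyperplaneParam ⁻¹' FrobeniusMfd.quadricRegion 𝕜)
        FrobeniusMfd.hyperplaneParam
        (fun τ => FrobeniusMfd.quadricF (FrobeniusMfd.hyperplaneParam τ)) ∧
      -- the metrics are antidiagonal
      (∀ t ∈ FrobeniusMfd.quadricRegion 𝕜,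
        FrobeniusMfd.metric FrobeniusMfd.quadricF t = FrobeniusMfd.antidiagonal 4) ∧
      ∀ τ ∈ (FrobeniusMfd.hyperplaneParam ⁻¹' FrobeniusMfd.quadricRegion 𝕜 :
          Set (Fin 3 → 𝕜)),
        FrobeniusMfd.inducedMetric FrobeniusMfd.quadricF FrobeniusMfd.hyperplaneParam τ =
          FrobeniusMfd.antidiagonal 3 ∧
        -- the Euler vector field is tangent to the hyperplane, and `E_N` is as given
        FrobeniusMfd.proj FrobeniusMfd.quadricF FrobeniusMfd.hyperplaneParam τ
            (FrobeniusMfd.quadricE (FrobeniusMfd.hyperplaneParam τ)) =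
          ![1 / 2 * τ 0, ((Real.sqrt 2 : ℝ) : 𝕜), -(1 / 2) * τ 2] ∧
        fderiv 𝕜 FrobeniusMfd.hyperplaneParam τ
            ![1 / 2 * τ 0, ((Real.sqrt 2 : ℝ) : 𝕜), -(1 / 2) * τ 2] =
          FrobeniusMfd.quadricE (FrobeniusMfd.hyperplaneParam τ) ∧
        -- the induced prepotential in terms of the contracted invariants
        HasSum
          (fun n : ℕ => (FrobeniusMfd.contractedN (n + 1) : 𝕜) /
            ((2 * (n + 1) - 1).factorial : 𝕜) * τ 2 ^ (2 * (n + 1) - 1) *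
            NormedSpace.exp (((n + 1 : ℕ) : 𝕜) * τ 1 / ((Real.sqrt 2 : ℝ) : 𝕜)))
          (FrobeniusMfd.quadricF (FrobeniusMfd.hyperplaneParam τ) -
            (1 / 2 * τ 0 ^ 2 * τ 2 + 1 / 2 * τ 0 * τ 1 ^ 2))) ∧
    -- the recursion for the contracted invariants
    FrobeniusMfd.contractedN 1 = 2 ∧
    ∀ n : ℕ, 2 ≤ n →
      (FrobeniusMfd.contractedN n : ℚ) =
        1 / 4 * ((2 * n - 4).factorial : ℚ) *
          ∑ p ∈ (Finset.HasAntidiagonal.antidiagonal n).filter (fun p => 1 ≤ p.1 ∧ 1 ≤ p.2),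
            (p.1 : ℚ) * p.2 * (p.1 * p.2 * (n + 1) - (p.1 ^ 2 + p.2 ^ 2)) *
                FrobeniusMfd.contractedN p.1 * FrobeniusMfd.contractedN p.2 /
              (((2 * p.1 - 1).factorial : ℚ) * ((2 * p.2 - 1).factorial : ℚ)) := by
  open FrobeniusMfd in
  refine ⟨⟨isQuadricCount_quadricN, fun N h => h.eq_quadricN⟩, fun 𝕜 _ => ⟨?_, ?_, ?_⟩,
    contractedN_one, contractedN_rec⟩
  · exact FrobeniusMfd.isNaturalFrobeniusSubmanifold_hyperplane
  · exact fun t ht => FrobeniusMfd.metric_quadricF ht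
  · exact fun τ hτ => ⟨FrobeniusMfd.inducedMetric_hyperplane hτ, FrobeniusMfd.proj_quadricE hτ,
      (FrobeniusMfd.fderiv_hyperplaneParam _ _).trans
        (FrobeniusMfd.hyperplaneParam_restrictedE τ), FrobeniusMfd.hasSum_restrictedF hτ⟩
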